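/- Let $S$ be a Polish space with its Borel $\sigma$-algebra and let $P_0$ be a diffuse (atomless) probability measure on $S$. Let $\mathcal P(S)$ be the space of Borel probability measures on $S$ with the topology of weak convergence, and write $\mathsf{Be}(a,b)$ for the Beta distribution. All random probability measures below are measurable maps from some probability space into $\mathcal P(S)$. A species sampling process with weights $(w_j)_{j\ge1}$ and base measure $P_0$ is a random probability measure $\mu$ with $\mu=\sum_{j\ge1}w_j\delta_{\xi_j}$ almost surely, where $(\xi_j)_{j\ge 1}$ are i.i.d. with law $P_0$ and independent of the weights $w_j\in[0,1]$. Let $\alpha,\theta>0$ and $\kappa\in\{0,1,2,\dots\}$. A Beta chain with parameters $(\kappa,\alpha,\theta)$ is a $[0,1]$-valued Markov chain $(v_i)_{i\ge1}$ with $v_1\sim\mathsf{Be}(\alpha,\theta)$ and transition probabilities $$\mathbb P[v_{i+1}\in A\mid v_i=v]=\sum_{x=0}^{\kappa}\binom{\kappa}{x}v^x(1-v)^{\kappa-x}\,\mathsf{Be}(\alpha+x,\theta+\kappa-x)(A).$$ A Beta-Binomial stick-breaking (BBSB) prior with parameters $(\kappa,\alpha,\theta,P_0)$ is a species sampling process with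 base measure $P_0$ and weights $w_j=v_j\prod_{i<j}(1-v_i)$, $j\ge1$, for such a Beta chain. The Geometric process with parameters $(\alpha,\theta,P_0)$ is a species sampling process with base measure $P_0$ and weights $w_j=\lambda(1-\lambda)^{j-1}$, $j\ge1$, where $\lambda\sim\mathsf{Be}(\alpha,\theta)$. A Dirichlet process with parameters $(\theta,P_0)$ is a random probability measure $\mu$ such that, for every finite measurable partition $A_1,\dots,A_n$ of $S$, the vector $(\mu(A_1),\dots,\mu(A_n))$ has the Dirichlet distribution with parameters $(\theta P_0(A_1),\dots,\theta P_0(A_n))$ (coordinates with parameter $0$ being $0$ almost surely). **Theorem.** Let $\mu^{(\kappa)}$ be a BBSB prior with parameters $(\kappa,\alpha,\theta,P_0)$, for $\kappa=0,1,2,\dots$. (i) For $\kappa=0$ and $\alpha=1$, $\mu^{(0)}$ is a Dirichlet process with parameters $(\theta,P_0)$. (ii) For any fixed $\alpha,\theta>0$, as $\kappa\to\infty$, $\mu^{(\kappa)}$ converges in distribution, as a random element of $\mathcal P(S)$, to the Geometric process with parameters $(\alpha,\theta,P_0)$. -/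

import Mathlib

open MeasureTheory ProbabilityTheory Filter
open scoped unitInterval Topology

namespace BBSB

/-! ### Convergence in distribution of random probability measures

`ProbabilityMeasure S` carries the topology of weak convergence and the σ-algebra generated by the
evaluations `P ↦ P B`.  On a separable metrizable space weakly open sets are measurable; this is
what `TendstoInDistribution` needs to make sense for random probability measures. -/

/-- Weakly open sets of probability measures belong to the σ-algebra generated by evaluations. -/
instance instOpensMeasurableSpaceProbabilityMeasure (S : Type*) [TopologicalSpace S]
    [TopologicalSpace.PseudoMetrizableSpace S] [SecondCountableTopology S] [MeasurableSpace S]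
    [OpensMeasurableSpace S] : OpensMeasurableSpace (ProbabilityMeasure S) := by
  classical
  let B := TopologicalSpace.countableBasis S
  let ι := {A : Set (Set S) // A.Finite ∧ A ⊆ B}
  have hcount : Countable ι :=
    (Set.countable_ofPred_finite_subset
      (TopologicalSpace.countable_countableBasis S)).to_subtype
  have hopen : ∀ A : ι, IsOpen (⋃₀ A.1) := fun A =>
    isOpen_sUnion fun t ht => TopologicalSpace.isOpen_of_mem_countableBasis (A.2.2 ht)
  let T : ProbabilityMeasure S → (ι × ℕ → ENNReal) := fun μ p =>
    ∫⁻ x, ((hopen p.1).isClosed_compl.apprSeq p.2 x : ENNReal) ∂(μ : Measure S)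
  have hT : Measurable T := by
    refine measurable_pi_lambda _ fun p => ?_
    refine (Measure.measurable_lintegral ?_).comp measurable_subtype_coe
    exact (((hopen p.1).isClosed_compl.apprSeq p.2).continuous.measurable).coe_nnreal_ennreal
  have key : ∀ μ : ProbabilityMeasure S, Tendsto id (comap T (𝓝 (T μ))) (𝓝 μ) := by
    intro μ
    refine tendsto_of_forall_isOpen_le_liminf' fun G hG => ?_
    refine le_of_forall_lt fun c hc => ?_
    obtain ⟨d, hcd, hd⟩ := exists_between hc
    refine hcd.trans_le ?_
    refine le_liminf_of_le (by isBoundedDefault) ?_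
    obtain ⟨A, hAB, rfl⟩ := (TopologicalSpace.isBasis_countableBasis S).open_eq_sUnion hG
    have hA : A.Countable := (TopologicalSpace.countable_countableBasis S).mono hAB
    obtain ⟨F, hFfin, hFA, hdF⟩ : ∃ F : Set (Set S), F.Finite ∧ F ⊆ A ∧
        d < (μ : Measure S) (⋃₀ F) := by
      rcases A.eq_empty_or_nonempty with rfl | hne
      · simp at hd
      obtain ⟨u, rfl⟩ := hA.exists_eq_range hne
      rw [Set.sUnion_range, measure_iUnion_eq_iSup_accumulate, lt_iSup_iff] at hd
      obtain ⟨n, hn⟩ := hd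
      refine ⟨u '' Set.Iic n, (Set.finite_Iic n).image u, Set.image_subset_range _ _, ?_⟩
      rw [Set.sUnion_image]
      simpa [Set.accumulate_def] using hn
    let a : ι := ⟨F, hFfin, hFA.trans hAB⟩
    have hm : MeasurableSet (⋃₀ F) := (hopen a).measurableSet
    have h1 : (μ : Measure S) (⋃₀ F)ᶜ < 1 - d := by
      rw [prob_compl_eq_one_sub hm]
      refine lt_of_not_ge fun h => absurd hdF (not_lt.mpr ?_)
      have h' := tsub_le_tsub_left h (1 : ENNReal)
      rwa [ENNReal.sub_sub_cancel ENNReal.one_ne_top prob_le_one,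
        ENNReal.sub_sub_cancel ENNReal.one_ne_top (hdF.le.trans prob_le_one)] at h'
    obtain ⟨n, hn⟩ := ((HasOuterApproxClosed.tendsto_lintegral_apprSeq
      (hopen a).isClosed_compl (μ : Measure S)).eventually_lt_const h1).exists
    have h2 : ∀ᶠ ν in comap T (𝓝 (T μ)), T ν (a, n) < 1 - d := by
      have : Tendsto (fun ν => T ν (a, n)) (comap T (𝓝 (T μ))) (𝓝 (T μ (a, n))) :=
        ((continuous_apply (a, n)).tendsto (T μ)).comp tendsto_comap
      exact this.eventually_lt_const hn
    filter_upwards [h2] with ν hν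
    have h3 : (ν : Measure S) (⋃₀ F)ᶜ < 1 - d :=
      (HasOuterApproxClosed.measure_le_lintegral (hopen a).isClosed_compl _ n).trans_lt hν
    rw [prob_compl_eq_one_sub hm] at h3
    have h4 : d < (ν : Measure S) (⋃₀ F) := by
      by_contra h
      exact absurd h3 (not_lt.mpr (tsub_le_tsub_left (not_lt.mp h) 1))
    exact h4.le.trans (measure_mono (Set.sUnion_subset_sUnion hFA))
  refine ⟨MeasurableSpace.generateFrom_le fun G (hG : IsOpen G) => ?_⟩
  have hG' : ∀ μ : G, ∃ O : Set (ι × ℕ → ENNReal), IsOpen O ∧ T μ ∈ O ∧ T ⁻¹' O ⊆ G := by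
    intro μ
    obtain ⟨O, hO, hsub⟩ := key μ (hG.mem_nhds μ.2)
    obtain ⟨O', hO', hopen', hmem⟩ := mem_nhds_iff.mp hO
    exact ⟨O', hopen', hmem, (Set.preimage_mono hO').trans hsub⟩
  choose O hO hmem hsub using hG'
  have : G = T ⁻¹' (⋃ μ : G, O μ) := by
    rw [Set.preimage_iUnion]
    refine Set.Subset.antisymm (fun μ hμ => Set.mem_iUnion.mpr ⟨⟨μ, hμ⟩, hmem ⟨μ, hμ⟩⟩) ?_
    exact Set.iUnion_subset hsub
  rw [this]
  exact hT (isOpen_iUnion hO).measurableSet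

/-! ### Beta chains -/

/-- The Beta distribution `Be(a, b)` as a measure on `[0, 1]`. -/
noncomputable def betaLaw (a b : ℝ) : Measure I :=
  (betaMeasure a b).comap Subtype.val

/-- The transition kernel of the Beta chain with parameters `(κ, α, θ)`: the mixture
`∑ x ≤ κ, Bin(x | κ, v) • Be(α + x, θ + κ - x)`, i.e. first draw `x ∼ Bin(κ, v)`, then draw the
next state from `Be(α + x, θ + κ - x)`. -/
noncomputable def betaChainKernel (κ : ℕ) (α θ : ℝ) : Kernel I I where
  toFun v := ∑ x ∈ Finset.range (κ + 1),
    ENNReal.ofReal (κ.choose x * (v : ℝ) ^ x * (1 - (v : ℝ)) ^ (κ - x)) •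
      betaLaw (α + x) (θ + κ - x)
  measurable' := by
    refine Measure.measurable_of_measurable_coe _ fun s _ => ?_
    simp only [Measure.coe_finsetSum, Finset.sum_apply, Measure.smul_apply, smul_eq_mul]
    fun_prop

lemma isProbabilityMeasure_betaLaw {a b : ℝ} (ha : 0 < a) (hb : 0 < b) :
    IsProbabilityMeasure (betaLaw a b) := by
  have := isProbabilityMeasureBeta ha hb
  have h0 : betaMeasure a b (Set.Icc 0 1)ᶜ = 0 := by
    rw [betaMeasure, withDensity_apply _ measurableSet_Icc.compl]
    refine setLIntegral_eq_zero measurableSet_Icc.compl fun x hx => ?_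
    rw [Set.mem_compl_iff, Set.mem_Icc, not_and_or, not_le, not_le] at hx
    rcases hx with hx | hx
    · exact betaPDF_eq_zero_of_nonpos hx.le
    · exact betaPDF_eq_zero_of_one_le hx.le
  constructor
  rw [betaLaw, (MeasurableEmbedding.subtype_coe measurableSet_Icc).comap_apply,
    Set.image_univ, Subtype.range_coe, ← prob_compl_eq_zero_iff measurableSet_Icc]
  exact h0

/-- For positive parameters the transition kernel is a Markov kernel. -/
lemma isMarkovKernel_betaChainKernel (κ : ℕ) {α θ : ℝ} (hα : 0 < α) (hθ : 0 < θ) :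
    IsMarkovKernel (betaChainKernel κ α θ) := by
  refine ⟨fun v => ⟨?_⟩⟩
  change (∑ x ∈ Finset.range (κ + 1),
    ENNReal.ofReal (κ.choose x * (v : ℝ) ^ x * (1 - (v : ℝ)) ^ (κ - x)) •
      betaLaw (α + x) (θ + κ - x)) Set.univ = 1
  have hv0 : (0 : ℝ) ≤ v := v.2.1
  have hv1 : (0 : ℝ) ≤ 1 - v := sub_nonneg.mpr v.2.2
  have hx : ∀ x ∈ Finset.range (κ + 1), betaLaw (α + x) (θ + κ - x) Set.univ = 1 := by
    intro x hx
    have hxκ : (x : ℝ) ≤ κ := by exact_mod_cast Finset.mem_range_succ_iff.mp hx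
    have := isProbabilityMeasure_betaLaw (a := α + x) (b := θ + κ - x)
      (by positivity) (by linarith)
    exact measure_univ
  simp only [Measure.coe_finsetSum, Finset.sum_apply, Measure.smul_apply, smul_eq_mul]
  rw [Finset.sum_congr rfl fun x h => by rw [hx x h, mul_one],
    ← ENNReal.ofReal_sum_of_nonneg fun x _ => by positivity]
  have := add_pow (v : ℝ) (1 - v) κ
  rw [add_sub_cancel, one_pow] at this
  refine (congrArg ENNReal.ofReal ?_).trans ENNReal.ofReal_one
  refine (Finset.sum_congr rfl fun x _ => ?_).trans this.symm
  rw [mul_assoc, mul_comm]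

/-- `V 0, V 1, …` is a Beta chain with parameters `(κ, α, θ)`: a Markov chain started from
`Be(α, θ)` such that, for every `n`, the conditional law of `V (n + 1)` given `V 0, …, V n` is
`betaChainKernel κ α θ (V n)`. -/
structure IsBetaChain {Ω : Type*} [MeasurableSpace Ω] (κ : ℕ) (α θ : ℝ) (V : ℕ → Ω → I)
    (P : Measure Ω) : Prop where
  measurable : ∀ i, Measurable (V i)
  initial : HasLaw (V 0) (betaLaw α θ) P
  transition : ∀ n, HasCondDistrib (V (n + 1)) (fun ω (i : Finset.Iic n) => V i ω)
    ((betaChainKernel κ α θ).comap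
      (fun h : Finset.Iic n → I => h ⟨n, Finset.mem_Iic.mpr le_rfl⟩) (by fun_prop)) P

/-! ### Species sampling processes -/

/-- `μ` is a (proper) species sampling process with weights `W 0, W 1, …` and base measure `P₀`:
a random probability measure that is almost surely `∑ j, W j • δ_{ξ j}` for some sequence of
atoms `ξ j`, i.i.d. from `P₀` and independent of the weights. (Since `μ` takes values in
probability measures, the weights sum to one almost surely.) -/
structure IsSpeciesSampling {S Ω : Type*} [MeasurableSpace S] [MeasurableSpace Ω]
    (W : ℕ → Ω → I) (P₀ : Measure S) (μ : Ω → ProbabilityMeasure S) (P : Measure Ω) : Prop where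
  measurable : Measurable μ
  exists_atoms : ∃ ξ : ℕ → Ω → S, (∀ j, Measurable (ξ j)) ∧ (∀ j, HasLaw (ξ j) P₀ P) ∧
    iIndepFun ξ P ∧ IndepFun (fun ω j => W j ω) (fun ω j => ξ j ω) P ∧
    ∀ᵐ ω ∂P, (μ ω : Measure S) =
      Measure.sum fun j => ENNReal.ofReal (W j ω : ℝ) • Measure.dirac (ξ j ω)

/-- Stick-breaking weights `w j = v j * ∏ i < j, (1 - v i)` with length variables `v`. -/
noncomputable def stickBreaking (v : ℕ → I) (j : ℕ) : I :=
  v j * ∏ i ∈ Finset.range j, σ (v i)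

/-- `μ` is a Beta-Binomial stick-breaking prior with parameters `(κ, α, θ, P₀)`. -/
def IsBBSBPrior {S Ω : Type*} [MeasurableSpace S] [MeasurableSpace Ω] (κ : ℕ) (α θ : ℝ)
    (P₀ : Measure S) (μ : Ω → ProbabilityMeasure S) (P : Measure Ω) : Prop :=
  ∃ V : ℕ → Ω → I, IsBetaChain κ α θ V P ∧
    IsSpeciesSampling (fun j ω => stickBreaking (fun i => V i ω) j) P₀ μ P

/-- `μ` is a Geometric process with parameters `(α, θ, P₀)`: the weights are
`w j = l * (1 - l) ^ j`, `j = 0, 1, …`, for some `l ∼ Be(α, θ)`. -/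
def IsGeometricProcess {S Ω : Type*} [MeasurableSpace S] [MeasurableSpace Ω] (α θ : ℝ)
    (P₀ : Measure S) (μ : Ω → ProbabilityMeasure S) (P : Measure Ω) : Prop :=
  ∃ l : Ω → I, Measurable l ∧ HasLaw l (betaLaw α θ) P ∧
    IsSpeciesSampling (fun j ω => l ω * σ (l ω) ^ j) P₀ μ P

/-! ### The Dirichlet process -/

/-- The Gamma distribution with shape `a ≥ 0` and rate `1`, degenerate at `0` when `a = 0`. -/
noncomputable def gammaLaw (a : ℝ) : Measure ℝ :=
  if a = 0 then Measure.dirac 0 else gammaMeasure a 1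

/-- The Dirichlet distribution with parameters `a i ≥ 0`, not all zero: the law of
`(Z i / ∑ j, Z j)` with independent `Z i ∼ Gamma(a i, 1)`. -/
noncomputable def dirichletLaw {n : ℕ} (a : Fin n → ℝ) : Measure (Fin n → ℝ) :=
  (Measure.pi fun i => gammaLaw (a i)).map fun z i => z i / ∑ j, z j

/-- `μ` is a Dirichlet process with parameters `(θ, P₀)` in the sense of Ferguson: for every finite
measurable partition `A 0, …, A (n - 1)` of the space, `(μ (A 0), …, μ (A (n - 1)))` has the
Dirichlet distribution with parameters `(θ P₀(A 0), …, θ P₀(A (n - 1)))`. -/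
structure IsDirichletProcess {S Ω : Type*} [MeasurableSpace S] [MeasurableSpace Ω] (θ : ℝ)
    (P₀ : Measure S) (μ : Ω → ProbabilityMeasure S) (P : Measure Ω) : Prop where
  measurable : Measurable μ
  partition : ∀ (n : ℕ) (A : Fin n → Set S), (∀ i, MeasurableSet (A i)) →
    Pairwise (Function.onFun Disjoint A) → (⋃ i, A i) = Set.univ →
    HasLaw (fun ω i => (μ ω : Measure S).real (A i)) (dirichletLaw fun i => θ * P₀.real (A i)) P

end BBSB

/-!
# Beta-Binomial stick-breaking priors: from the Dirichlet to the Geometric process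

**The Dirichlet process.** For `κ = 0` and `α = 1` the sticks are independent `Be(1, θ)`
variables. Fix a partition `A` of the space. The Dirichlet law `D` with parameters `θ P₀(A i)`
solves the distributional equation `Y = v e + (1 - v) Y`, where `v ∼ Be(1, θ)` and `e` is the
indicator vector of the cell of a point drawn from `P₀` (`dirichletLaw_distributional_equation`,
`lintegral_dirichletLaw_invariant`). Hence breaking `n` sticks and filling the remaining mass with
an independent vector of law `D` gives a vector of law `D` for every `n`
(`lintegral_stickPartial`). The remaining mass vanishes as `n → ∞`, because the weights of a
random probability measure sum to one, so the vector of masses of the cells has law `D`.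

The distributional equation is Gamma calculus. Let `Z i ∼ Gamma(a i)` be independent with sum `S`.
By scaling, tilting their joint law by `exp (-u S)` amounts to dividing `Z` by `1 + u` and
multiplying by `(1 + u) ^ (-θ)` (`lintegral_pi_gammaLaw_exp_mul`). Integrating out `u` shows that
the proportions `Z / S` are uncorrelated with `S` (`lintegral_pi_gammaLaw_sum_mul`), and that, for
an independent exponential variable `E`, the ratio `E / (E + S)` is `Be(1, θ)` and independent of
`Z / S` (`lintegral_pi_gammaLaw_tilt`, `lintegral_betaLaw_one`). Adding `E` to the coordinate `i`
turns `Gamma(a i)` into `Gamma(a i + 1)`, that is, biases the law by `Z i`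
(`lintegral_pi_gammaLaw_add_exp`), and the biases by the different coordinates sum to `S`.

**The Geometric process.** Given `v`, a binomial proportion `x / κ` is at mean square distance
`O(1 / κ)` from `v` (the variance of Bernstein polynomials), and `Be(α + x, θ + κ - x)` is as
close to `x / κ`. So the steps of the Beta chain vanish in mean square as `κ → ∞`, uniformly in
the state (`lintegral_betaChainKernel_sub_sq_le`), while the initial law is `Be(α, θ)` for every
`κ`: on the compact space of sequences in `[0, 1]`, the chain converges in law to a constant
sequence (`tendsto_integral_betaChain`). Stick-breaking is continuous, which gives convergence of
the weights, jointly with the independent atoms. Finally `∑ j, w j δ_{x j}` is a continuous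
function of `(w, x)` on the set where `∑ j, w j = 1` (`continuous_speciesMeasure`), and this set
carries all the laws involved, so the continuous mapping argument, run on open sets, concludes
(`tendstoInDistribution_of_isSpeciesSampling`).
-/

namespace BBSB

open Set ENNReal

/-! ### Gamma distributions -/

lemma lintegral_gammaLaw {a : ℝ} (ha : 0 < a) {g : ℝ → ℝ≥0∞} (hg : Measurable g) :
    ∫⁻ z, g z ∂gammaLaw a =
      ∫⁻ z in Ioi 0, ENNReal.ofReal (z ^ (a - 1) * Real.exp (-z) / Real.Gamma a) * g z := by
  rw [gammaLaw, if_neg ha.ne', gammaMeasure, lintegral_withDensity_eq_lintegral_mul _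
    (by exact (measurable_gammaPDFReal a 1).ennreal_ofReal) hg, ← setLIntegral_univ,
    ← Iic_union_Ioi (a := (0 : ℝ)), lintegral_union measurableSet_Ioi (Iic_disjoint_Ioi le_rfl),
    setLIntegral_congr Iio_ae_eq_Iic.symm,
      setLIntegral_eq_zero measurableSet_Iio, zero_add]
  · refine setLIntegral_congr_fun measurableSet_Ioi fun z hz => ?_
    simp only [Pi.mul_apply]
    rw [gammaPDF_of_nonneg (le_of_lt hz)]
    congr 2
    simp
    ring
  · intro z hz
    simp [gammaPDF_of_neg hz]

lemma isProbabilityMeasure_gammaLaw {a : ℝ} (ha : 0 ≤ a) :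
    IsProbabilityMeasure (gammaLaw a) := by
  rcases ha.eq_or_lt with rfl | ha
  · rw [gammaLaw, if_pos rfl]; infer_instance
  · rw [gammaLaw, if_neg ha.ne']; exact isProbabilityMeasure_gammaMeasure ha one_pos

lemma lintegral_rpow_Ioo {a t : ℝ} (ha : 0 < a) (ht : 0 < t) :
    ∫⁻ x in Ioo 0 t, ENNReal.ofReal (x ^ (a - 1)) = ENNReal.ofReal (t ^ a / a) := by
  have hint := (intervalIntegrable_iff_integrableOn_Ioo_of_le ht.le).1
    (intervalIntegral.intervalIntegrable_rpow' (a := 0) (b := t) (r := a - 1) (by linarith))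
  rw [← ofReal_integral_eq_lintegral_ofReal hint
    (ae_restrict_of_forall_mem measurableSet_Ioo fun x hx => Real.rpow_nonneg hx.1.le _),
    ← integral_Ioc_eq_integral_Ioo, ← intervalIntegral.integral_of_le ht.le,
    integral_rpow (Or.inl (by linarith))]
  simp [Real.zero_rpow ha.ne']

/-- Adding an independent `Exp(1)` variable to a `Gamma(a)` variable gives a `Gamma(a + 1)`
variable, whose law is the size-biased `Gamma(a)` law. Both sides vanish when `a = 0`. -/
lemma lintegral_gammaLaw_add_exp {a : ℝ} (ha : 0 ≤ a) {g : ℝ → ℝ≥0∞} (hg : Measurable g) :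
    ENNReal.ofReal a * ∫⁻ z, (∫⁻ e in Ioi 0, ENNReal.ofReal (Real.exp (-e)) * g (z + e))
      ∂gammaLaw a = ∫⁻ z, ENNReal.ofReal z * g z ∂gammaLaw a := by
  rcases ha.eq_or_lt with rfl | ha
  · simp [gammaLaw]
  have hΓ := Real.Gamma_pos_of_pos ha
  -- Substitute `t = z + e`, exchange the integrals, and integrate `z ^ (a - 1)` over `(0, t)`.
  have h1 : ∀ z : ℝ, ∫⁻ e in Ioi 0, ENNReal.ofReal (Real.exp (-e)) * g (z + e) =
      ∫⁻ t, (Ioi z).indicator (fun t => ENNReal.ofReal (Real.exp (-(t - z))) * g t) t := by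
    intro z
    rw [← lintegral_indicator measurableSet_Ioi, ← lintegral_add_right_eq_self _ (-z)]
    refine lintegral_congr fun t => ?_
    by_cases h : z < t
    · rw [indicator_of_mem (by simpa using h), indicator_of_mem (by simpa using h)]
      simp [sub_eq_add_neg]
    · rw [indicator_of_notMem (by simpa using h), indicator_of_notMem (by simpa using h)]
  have hm2 : Measurable fun p : ℝ × ℝ =>
      (Ioi p.1).indicator (fun t => ENNReal.ofReal (Real.exp (-(t - p.1))) * g t) p.2 := by
    have : (fun p : ℝ × ℝ =>
      (Ioi p.1).indicator (fun t => ENNReal.ofReal (Real.exp (-(t - p.1))) * g t) p.2) =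
      {p : ℝ × ℝ | p.1 < p.2}.indicator
        fun p => ENNReal.ofReal (Real.exp (-(p.2 - p.1))) * g p.2 := by
      ext p; simp [indicator]
    rw [this]
    exact Measurable.indicator (by fun_prop) (measurableSet_lt measurable_fst measurable_snd)
  simp_rw [h1]
  rw [lintegral_gammaLaw ha hm2.lintegral_prod_right', lintegral_gammaLaw ha (by fun_prop),
    ← lintegral_const_mul _ (by fun_prop)]
  have h2 : ∀ z : ℝ, ENNReal.ofReal a * (ENNReal.ofReal (z ^ (a - 1) * Real.exp (-z) /
      Real.Gamma a) * ∫⁻ t, (Ioi z).indicator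
        (fun t => ENNReal.ofReal (Real.exp (-(t - z))) * g t) t) =
      ∫⁻ t, ENNReal.ofReal a * (ENNReal.ofReal (z ^ (a - 1) * Real.exp (-z) /
      Real.Gamma a) * (Ioi z).indicator
        (fun t => ENNReal.ofReal (Real.exp (-(t - z))) * g t) t) := by
    intro z
    have hmz : Measurable ((Ioi z).indicator
        (fun t => ENNReal.ofReal (Real.exp (-(t - z))) * g t)) :=
      Measurable.indicator (by fun_prop) measurableSet_Ioi
    rw [lintegral_const_mul _ (by fun_prop), lintegral_const_mul _ (by fun_prop)]
  refine (lintegral_congr fun z => h2 z).trans ?_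
  rw [lintegral_lintegral_swap (by fun_prop), ← lintegral_indicator measurableSet_Ioi]
  refine lintegral_congr fun t => ?_
  rw [← lintegral_indicator measurableSet_Ioi]
  have h3 : ∀ z : ℝ, (Ioi (0 : ℝ)).indicator (fun z => ENNReal.ofReal a * (ENNReal.ofReal
      (z ^ (a - 1) * Real.exp (-z) / Real.Gamma a) * (Ioi z).indicator
        (fun t => ENNReal.ofReal (Real.exp (-(t - z))) * g t) t)) z =
      (Ioo 0 t).indicator (fun z => ENNReal.ofReal (z ^ (a - 1)) *
        (ENNReal.ofReal (a * Real.exp (-t) / Real.Gamma a) * g t)) z := by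
    intro z
    by_cases hz : z ∈ Ioi (0 : ℝ)
    · by_cases hzt : z < t
      · rw [indicator_of_mem hz, indicator_of_mem (show t ∈ Ioi z from hzt),
          indicator_of_mem (show z ∈ Ioo 0 t from ⟨hz, hzt⟩), ← mul_assoc, ← mul_assoc,
          ← mul_assoc, ← ENNReal.ofReal_mul ha.le, ← ENNReal.ofReal_mul,
          ← ENNReal.ofReal_mul (Real.rpow_nonneg (le_of_lt hz) _)]
        · congr 2
          rw [show -t = -z + -(t - z) by ring, Real.exp_add]
          ring
        · have := Real.rpow_nonneg (le_of_lt hz) (a - 1)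
          positivity
      · rw [indicator_of_mem hz, indicator_of_notMem (show t ∉ Ioi z from hzt),
          indicator_of_notMem (show z ∉ Ioo 0 t from fun h => hzt h.2), mul_zero, mul_zero]
    · rw [indicator_of_notMem hz, indicator_of_notMem (show z ∉ Ioo 0 t from fun h => hz h.1)]
  simp_rw [h3]
  rw [lintegral_indicator measurableSet_Ioo, lintegral_mul_const _ (by fun_prop)]
  by_cases ht : t ∈ Ioi (0 : ℝ)
  · have ht' : 0 < t := ht
    rw [indicator_of_mem ht, lintegral_rpow_Ioo ha ht, ← mul_assoc, ← mul_assoc,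
      ← ENNReal.ofReal_mul (by positivity), ← ENNReal.ofReal_mul (by positivity)]
    congr 2
    rw [Real.rpow_sub_one ht'.ne']
    field_simp
  · rw [indicator_of_notMem ht, Ioo_eq_empty (fun h => ht h)]
    simp

lemma lintegral_Ioi_comp_mul {c : ℝ} (hc : 0 < c) (g : ℝ → ℝ≥0∞) :
    ∫⁻ x in Ioi 0, g x = ∫⁻ x in Ioi 0, ENNReal.ofReal c * g (c * x) := by
  have := lintegral_image_eq_lintegral_abs_deriv_mul (s := Ioi (0 : ℝ)) (f := fun x => c * x)
    (f' := fun _ => c) measurableSet_Ioi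
    (fun x _ => by simpa using ((hasDerivAt_id x).const_mul c).hasDerivWithinAt)
    (fun x _ y _ h => mul_left_cancel₀ hc.ne' h) g
  rwa [image_mul_left_Ioi hc, mul_zero, abs_of_pos hc] at this

/-- The exponential tilt of a Gamma law is a multiple of a rescaled Gamma law. -/
lemma lintegral_gammaLaw_exp_mul {a c : ℝ} (ha : 0 ≤ a) (hc : 0 < c) {g : ℝ → ℝ≥0∞}
    (hg : Measurable g) :
    ∫⁻ z, ENNReal.ofReal (Real.exp (-((c - 1) * z))) * g z ∂gammaLaw a =
      ENNReal.ofReal (c ^ (-a)) * ∫⁻ z, g (c⁻¹ * z) ∂gammaLaw a := by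
  rcases ha.eq_or_lt with rfl | ha
  · simp [gammaLaw]
  have hΓ := Real.Gamma_pos_of_pos ha
  rw [lintegral_gammaLaw ha (by fun_prop), lintegral_gammaLaw ha (by fun_prop),
    lintegral_Ioi_comp_mul (inv_pos.2 hc), ← lintegral_const_mul _ (by fun_prop)]
  refine setLIntegral_congr_fun measurableSet_Ioi fun z (hz : 0 < z) => ?_
  have := Real.rpow_nonneg hz.le (a - 1)
  have := Real.rpow_nonneg (mul_pos (inv_pos.2 hc) hz).le (a - 1)
  rw [← mul_assoc (ENNReal.ofReal (_ / _)), ← mul_assoc (ENNReal.ofReal c⁻¹),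
    ← mul_assoc (ENNReal.ofReal (c ^ (-a))), ← ENNReal.ofReal_mul (by positivity),
    ← ENNReal.ofReal_mul (by positivity), ← ENNReal.ofReal_mul (by positivity)]
  congr 2
  rw [Real.mul_rpow (by positivity) hz.le, Real.inv_rpow hc.le, Real.rpow_neg hc.le,
    Real.rpow_sub_one hc.ne', show -z = -(c⁻¹ * z) + -((c - 1) * (c⁻¹ * z)) by field_simp; ring,
    Real.exp_add]
  have := Real.rpow_pos_of_pos hc a
  field_simp

/-! ### Vectors of independent Gamma variables -/

lemma ae_gammaLaw_nonneg {a : ℝ} (ha : 0 ≤ a) : ∀ᵐ z ∂gammaLaw a, 0 ≤ z := by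
  rcases ha.eq_or_lt with rfl | ha
  · simp [gammaLaw]
  · rw [ae_iff, ← lintegral_indicator_one (by measurability), lintegral_gammaLaw ha
      (measurable_one.indicator (by measurability))]
    refine setLIntegral_eq_zero measurableSet_Ioi fun z (hz : 0 < z) => ?_
    simp [indicator, hz.le]

lemma ae_gammaLaw_pos {a : ℝ} (ha : 0 < a) : ∀ᵐ z ∂gammaLaw a, 0 < z := by
  rw [ae_iff, ← lintegral_indicator_one (by measurability), lintegral_gammaLaw ha
      (measurable_one.indicator (by measurability))]
  refine setLIntegral_eq_zero measurableSet_Ioi fun z (hz : 0 < z) => ?_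
  simp [indicator, hz]

section GammaVectors

variable {n : ℕ} {a : Fin n → ℝ}

lemma ae_pi_gammaLaw_nonneg (ha : ∀ i, 0 ≤ a i) :
    ∀ᵐ z ∂Measure.pi fun i => gammaLaw (a i), ∀ i, 0 ≤ z i := by
  have := fun i => isProbabilityMeasure_gammaLaw (ha i)
  exact ae_all_iff.2 fun i => Measure.tendsto_eval_ae_ae.eventually (ae_gammaLaw_nonneg (ha i))

lemma ae_pi_gammaLaw_sum_pos (ha : ∀ i, 0 ≤ a i) (hθ : 0 < ∑ i, a i) :
    ∀ᵐ z ∂Measure.pi fun i => gammaLaw (a i), 0 < ∑ i, z i := by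
  have := fun i => isProbabilityMeasure_gammaLaw (ha i)
  obtain ⟨i, -, hi⟩ := Finset.exists_lt_of_sum_lt (s := Finset.univ) (f := fun _ : Fin n => (0 : ℝ))
    (g := a) (by simpa using hθ)
  have h := Measure.tendsto_eval_ae_ae (μ := fun i => gammaLaw (a i)) (i := i)
    |>.eventually (ae_gammaLaw_pos hi)
  filter_upwards [h, ae_pi_gammaLaw_nonneg ha] with z hz hz'
  exact Finset.sum_pos' (fun j _ => hz' j) ⟨i, Finset.mem_univ i, hz⟩

/-- Tonelli's theorem for a product measure, integrating the coordinate `i` first. -/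
lemma lintegral_pi_insertNth (μ : Fin (n + 1) → Measure ℝ) [∀ i, SigmaFinite (μ i)]
    (i : Fin (n + 1)) {F : (Fin (n + 1) → ℝ) → ℝ≥0∞} (hF : Measurable F) :
    ∫⁻ z, F z ∂Measure.pi μ =
      ∫⁻ y, (∫⁻ x, F (i.insertNth x y) ∂μ i) ∂Measure.pi fun j => μ (i.succAbove j) := by
  have h := (measurePreserving_piFinSuccAbove μ i).symm
  rw [← h.lintegral_comp hF]
  exact lintegral_prod_symm _ (hF.comp (MeasurableEquiv.measurable _)).aemeasurable

/-- Tilting independent Gamma variables by the exponential of their sum rescales all of them by the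
same factor. -/
lemma lintegral_pi_gammaLaw_exp_mul (ha : ∀ i, 0 ≤ a i) {c : ℝ} (hc : 0 < c)
    {h : (Fin n → ℝ) → ℝ≥0∞} (hh : Measurable h) :
    ∫⁻ z, ENNReal.ofReal (Real.exp (-((c - 1) * ∑ i, z i))) * h z
        ∂Measure.pi (fun i => gammaLaw (a i)) =
      ENNReal.ofReal (c ^ (-∑ i, a i)) *
        ∫⁻ z, h (c⁻¹ • z) ∂Measure.pi (fun i => gammaLaw (a i)) := by
  induction n with
  | zero => 
    simp only [Finset.univ_eq_empty, Finset.sum_empty, mul_zero, neg_zero, Real.exp_zero,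
      Real.rpow_zero, ENNReal.ofReal_one, one_mul]
    exact lintegral_congr fun z => congrArg h (Subsingleton.elim _ _)
  | succ n ih =>
    have := fun i => isProbabilityMeasure_gammaLaw (ha i)
    have hins : Measurable fun p : ℝ × (Fin n → ℝ) =>
        (Fin.insertNth 0 p.1 p.2 : Fin (n + 1) → ℝ) :=
      (MeasurableEquiv.piFinSuccAbove (fun _ => ℝ) (0 : Fin (n + 1))).symm.measurable
    have hins' : ∀ y : Fin n → ℝ, Measurable fun x : ℝ =>
        (Fin.insertNth 0 x y : Fin (n + 1) → ℝ) := fun y =>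
      hins.comp (measurable_id.prodMk measurable_const)
    rw [lintegral_pi_insertNth _ 0 (by fun_prop), lintegral_pi_insertNth _ 0 (by fun_prop)]
    have h1 : ∀ y : Fin n → ℝ, ∫⁻ x, ENNReal.ofReal (Real.exp (-((c - 1) *
          ∑ i, (Fin.insertNth 0 x y : Fin (n + 1) → ℝ) i))) * h (Fin.insertNth 0 x y)
          ∂gammaLaw (a 0) =
        ENNReal.ofReal (Real.exp (-((c - 1) * ∑ i, y i))) * (ENNReal.ofReal (c ^ (-a 0)) *
          ∫⁻ x, h (Fin.insertNth 0 (c⁻¹ * x) y) ∂gammaLaw (a 0)) := by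
      intro y
      have hm := hh.comp (hins' y)
      have key := lintegral_gammaLaw_exp_mul (ha 0) hc hm
      simp only [Function.comp_def] at hm key
      rw [← key, ← lintegral_const_mul _ (by fun_prop)]
      refine lintegral_congr fun x => ?_
      rw [Fin.sum_univ_succ, ← mul_assoc, ← ENNReal.ofReal_mul (by positivity), ← Real.exp_add]
      simp only [Fin.insertNth_zero', Fin.cons_zero, Fin.cons_succ]
      congr 3
      ring
    simp_rw [h1]
    have hm : Measurable fun y : Fin n → ℝ =>
        ∫⁻ x, h (Fin.insertNth 0 (c⁻¹ * x) y) ∂gammaLaw (a 0) := by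
      have : Measurable fun p : (Fin n → ℝ) × ℝ =>
          h (Fin.insertNth (0 : Fin (n + 1)) (c⁻¹ * p.2) p.1) :=
        hh.comp (hins.comp (((measurable_const_mul c⁻¹).comp measurable_snd).prodMk measurable_fst))
      exact this.lintegral_prod_right'
    rw [ih (fun i => ha _) (by fun_prop), lintegral_const_mul _ (by fun_prop), ← mul_assoc,
      ← ENNReal.ofReal_mul (by positivity), ← Real.rpow_add hc, Fin.sum_univ_succ]
    congr 2
    · simp
    · ext y
      refine lintegral_congr fun x => congrArg h ?_
      ext i
      refine Fin.cases ?_ (fun j => ?_) i <;> simp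

/-- Adding an independent `Exp(1)` variable to the coordinate `i` biases the joint law by this
coordinate. -/
lemma lintegral_pi_gammaLaw_add_exp (ha : ∀ i, 0 ≤ a i) (i : Fin n)
    {F : (Fin n → ℝ) → ℝ≥0∞} (hF : Measurable F) :
    ENNReal.ofReal (a i) * ∫⁻ z, (∫⁻ e in Ioi 0, ENNReal.ofReal (Real.exp (-e)) *
        F (z + Pi.single i e)) ∂Measure.pi (fun i => gammaLaw (a i)) =
      ∫⁻ z, ENNReal.ofReal (z i) * F z ∂Measure.pi (fun i => gammaLaw (a i)) := by
  obtain _ | n := n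
  · exact i.elim0
  have := fun i => isProbabilityMeasure_gammaLaw (ha i)
  have hsingle : Measurable fun e : ℝ => (Pi.single i e : Fin (n + 1) → ℝ) :=
    (continuous_single i).measurable
  have hins' : ∀ y : Fin n → ℝ, Measurable fun x : ℝ =>
      (Fin.insertNth i x y : Fin (n + 1) → ℝ) := fun y =>
    (MeasurableEquiv.piFinSuccAbove (fun _ => ℝ) i).symm.measurable.comp
      (measurable_id.prodMk measurable_const)
  have hm : Measurable fun z : Fin (n + 1) → ℝ => ∫⁻ e in Ioi 0, ENNReal.ofReal (Real.exp (-e)) *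
        F (z + Pi.single i e) := by
    have : Measurable fun p : (Fin (n + 1) → ℝ) × ℝ => ENNReal.ofReal (Real.exp (-p.2)) *
        F (p.1 + Pi.single i p.2) := by fun_prop
    exact this.lintegral_prod_right'
  rw [lintegral_pi_insertNth _ i (by fun_prop), lintegral_pi_insertNth _ i (by fun_prop),
    ← lintegral_const_mul']
  · refine lintegral_congr fun y => ?_
    have := lintegral_gammaLaw_add_exp (ha i) (hF.comp (hins' y))
    simp only [Function.comp_def] at this
    simp only [Fin.insertNth_apply_same]
    rw [← this]
    congr 1
    refine lintegral_congr fun x => lintegral_congr fun e => ?_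
    congr 2
    ext j
    refine i.succAboveCases ?_ (fun k => ?_) j <;> simp
  · exact ENNReal.ofReal_ne_top

/-! ### The distributional equation of the Dirichlet law -/

/-- The vector of proportions `z i / ∑ j, z j`; the Dirichlet distribution is its law when the `z i`
are independent Gamma variables. -/
noncomputable def proportions (z : Fin n → ℝ) : Fin n → ℝ := fun i => z i / ∑ j, z j

@[fun_prop]
lemma measurable_proportions : Measurable (proportions (n := n)) := by
  unfold proportions
  fun_prop

lemma proportions_smul {c : ℝ} (hc : c ≠ 0) (z : Fin n → ℝ) :
    proportions (c • z) = proportions z := by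
  ext i
  simp only [proportions, Pi.smul_apply, smul_eq_mul, ← Finset.mul_sum]
  rw [mul_div_mul_left _ _ hc]

lemma lintegral_dirichletLaw {f : (Fin n → ℝ) → ℝ≥0∞} (hf : Measurable f) :
    ∫⁻ y, f y ∂dirichletLaw a =
      ∫⁻ z, f (proportions z) ∂Measure.pi fun i => gammaLaw (a i) :=
  lintegral_map hf measurable_proportions

lemma isProbabilityMeasure_dirichletLaw (ha : ∀ i, 0 ≤ a i) :
    IsProbabilityMeasure (dirichletLaw a) := by
  have := fun i => isProbabilityMeasure_gammaLaw (ha i)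
  exact Measure.isProbabilityMeasure_map measurable_proportions.aemeasurable

lemma lintegral_exp_neg : ∫⁻ e in Ioi (0 : ℝ), ENNReal.ofReal (Real.exp (-e)) = 1 := by
  rw [← ofReal_integral_eq_lintegral_ofReal (integrableOn_exp_neg_Ioi 0)
    (ae_of_all _ fun x => (Real.exp_pos _).le), integral_exp_neg_Ioi]
  simp

lemma lintegral_rpow_one_add {θ : ℝ} (hθ : 0 < θ) :
    ENNReal.ofReal θ * ∫⁻ u in Ioi (0 : ℝ), ENNReal.ofReal ((1 + u) ^ (-(θ + 1))) = 1 := by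
  have h : ∫⁻ x in Ioi (1 : ℝ), ENNReal.ofReal (x ^ (-(θ + 1))) =
      ∫⁻ u in Ioi (0 : ℝ), ENNReal.ofReal ((1 + u) ^ (-(θ + 1))) := by
    rw [← lintegral_indicator measurableSet_Ioi, ← lintegral_indicator measurableSet_Ioi,
      ← lintegral_add_left_eq_self _ 1]
    refine lintegral_congr fun u => ?_
    simp [indicator]
  rw [← h, ← ofReal_integral_eq_lintegral_ofReal
    (integrableOn_Ioi_rpow_of_lt (by linarith) one_pos)
    (ae_restrict_of_forall_mem measurableSet_Ioi fun x (hx : 1 < x) =>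
      Real.rpow_nonneg (by linarith) _), integral_Ioi_rpow_of_lt (by linarith) one_pos,
    ← ENNReal.ofReal_mul hθ.le]
  simp
  field_simp

/-- Mixing the exponential tilts of the Gamma product measure over the rate: by scaling, the tilt
by `exp (-u ∑ z)` only contributes a power of `1 + u` when tested against functions of the
proportions. -/
lemma lintegral_pi_gammaLaw_tilt (ha : ∀ i, 0 ≤ a i)
    {k : ℝ → (Fin n → ℝ) → ℝ≥0∞} (hk : Measurable (Function.uncurry k)) :
    ∫⁻ z, (∫⁻ u in Ioi 0, ENNReal.ofReal (Real.exp (-(u * ∑ i, z i))) *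
        (ENNReal.ofReal (∑ i, z i) * k u (proportions z)))
        ∂Measure.pi (fun i => gammaLaw (a i)) =
      ∫⁻ u in Ioi 0, ENNReal.ofReal ((1 + u) ^ (-(∑ i, a i + 1))) *
        ∫⁻ z, ENNReal.ofReal (∑ i, z i) * k u (proportions z)
          ∂Measure.pi (fun i => gammaLaw (a i)) := by
  have := fun i => isProbabilityMeasure_gammaLaw (ha i)
  have hk2 : Measurable fun p : (Fin n → ℝ) × ℝ => k p.2 (proportions p.1) :=
    hk.comp (measurable_snd.prodMk (measurable_proportions.comp measurable_fst))
  rw [lintegral_lintegral_swap (by fun_prop)]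
  refine setLIntegral_congr_fun measurableSet_Ioi fun u (hu : 0 < u) => ?_
  have hc : 0 < 1 + u := by linarith
  have hku : Measurable fun z => k u (proportions z) :=
    hk2.comp (measurable_id.prodMk measurable_const)
  have key := lintegral_pi_gammaLaw_exp_mul ha hc
    (h := fun z => ENNReal.ofReal (∑ i, z i) * k u (proportions z)) (by fun_prop)
  rw [add_sub_cancel_left] at key
  refine key.trans ?_
  simp only [proportions_smul (inv_ne_zero hc.ne'), Pi.smul_apply, smul_eq_mul, ← Finset.mul_sum,
    ENNReal.ofReal_mul (inv_nonneg.2 hc.le), mul_assoc]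
  rw [lintegral_const_mul _ (by fun_prop), ← mul_assoc, ← ENNReal.ofReal_mul (by positivity)]
  congr 2
  rw [neg_add, Real.rpow_add hc, Real.rpow_neg_one]

/-- Under the Gamma product measure the proportions are uncorrelated with the total mass. -/
lemma lintegral_pi_gammaLaw_sum_mul (ha : ∀ i, 0 ≤ a i) (hθ : 0 < ∑ i, a i)
    {h : (Fin n → ℝ) → ℝ≥0∞} (hh : Measurable h) :
    ∫⁻ z, ENNReal.ofReal (∑ i, z i) * h (proportions z)
        ∂Measure.pi (fun i => gammaLaw (a i)) =
      ENNReal.ofReal (∑ i, a i) * ∫⁻ y, h y ∂dirichletLaw a := by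
  have key := lintegral_pi_gammaLaw_tilt ha (k := fun _ z => h z) (hh.comp measurable_snd)
  have h1 : ∫⁻ z, (∫⁻ u in Ioi 0, ENNReal.ofReal (Real.exp (-(u * ∑ i, z i))) *
        (ENNReal.ofReal (∑ i, z i) * h (proportions z)))
        ∂Measure.pi (fun i => gammaLaw (a i)) = ∫⁻ y, h y ∂dirichletLaw a := by
    -- Integrating out `u` gives back `h`, since `∫ S exp (-u S) du = 1`.
    rw [lintegral_dirichletLaw hh]
    refine lintegral_congr_ae ?_
    filter_upwards [ae_pi_gammaLaw_sum_pos ha hθ] with z hz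
    have := lintegral_exp_neg
    rw [lintegral_Ioi_comp_mul hz] at this
    conv_rhs => rw [← one_mul (h _), ← this]
    rw [← lintegral_mul_const _ (by fun_prop)]
    refine lintegral_congr fun u => ?_
    rw [mul_comm u]
    ring
  rw [← h1, key, lintegral_mul_const _ (by fun_prop), ← mul_assoc, lintegral_rpow_one_add hθ,
    one_mul]

lemma lintegral_betaLaw {b c : ℝ} {F : ℝ → ℝ≥0∞} (hF : Measurable F) :
    ∫⁻ v, F v ∂betaLaw b c = ∫⁻ x in Ioo 0 1,
      ENNReal.ofReal (1 / beta b c * x ^ (b - 1) * (1 - x) ^ (c - 1)) * F x := by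
  have hsub := MeasurableEmbedding.subtype_coe (s := I) measurableSet_Icc
  have hpdf : Measurable (betaPDF b c) := (measurable_betaPDFReal b c).ennreal_ofReal
  rw [betaLaw, ← hsub.lintegral_map, hsub.map_comap, Subtype.range_coe, betaMeasure,
    restrict_withDensity measurableSet_Icc,
    lintegral_withDensity_eq_lintegral_mul _ hpdf hF,
    setLIntegral_congr Ioo_ae_eq_Icc.symm]
  refine setLIntegral_congr_fun measurableSet_Ioo fun x hx => ?_
  simp only [Pi.mul_apply]
  rw [betaPDF_of_pos_lt_one hx.1 hx.2]

/-- `Be(1, θ)` is the law of `u / (1 + u)` when `u` has density `θ (1 + u) ^ (-(θ + 1))`. -/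
lemma lintegral_betaLaw_one {θ : ℝ} (hθ : 0 < θ) {F : ℝ → ℝ≥0∞} (hF : Measurable F) :
    ∫⁻ v, F v ∂betaLaw 1 θ = ENNReal.ofReal θ *
      ∫⁻ u in Ioi 0, ENNReal.ofReal ((1 + u) ^ (-(θ + 1))) * F (u / (1 + u)) := by
  have himg : (fun v : ℝ => v / (1 - v)) '' Ioo 0 1 = Ioi 0 := by
    ext u
    simp only [mem_image, mem_Ioo, mem_Ioi]
    constructor
    · rintro ⟨v, hv, rfl⟩
      exact div_pos hv.1 (by linarith)
    · intro hu
      refine ⟨u / (1 + u), ⟨by positivity, by rw [div_lt_one (by positivity)]; linarith⟩, ?_⟩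
      field_simp
      ring
  have hder : ∀ v ∈ Ioo (0 : ℝ) 1,
      HasDerivWithinAt (fun v : ℝ => v / (1 - v)) (1 / (1 - v) ^ 2) (Ioo 0 1) v := by
    intro v hv
    have h1 : 1 - v ≠ 0 := by linarith [hv.2]
    exact (((hasDerivAt_id' v).div ((hasDerivAt_id' v).const_sub 1) h1).congr_deriv
      (by simp)).hasDerivWithinAt
  have hinj : InjOn (fun v : ℝ => v / (1 - v)) (Ioo 0 1) := by
    intro v hv w hw (h : v / (1 - v) = w / (1 - w))
    have h1 : 1 - v ≠ 0 := by linarith [hv.2]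
    have h2 : 1 - w ≠ 0 := by linarith [hw.2]
    field_simp at h
    linarith
  rw [← himg, lintegral_image_eq_lintegral_abs_deriv_mul measurableSet_Ioo hder hinj,
    lintegral_betaLaw hF, ← lintegral_const_mul _ (by fun_prop)]
  refine setLIntegral_congr_fun measurableSet_Ioo fun v hv => ?_
  have h1 : 0 < 1 - v := by linarith [hv.2]
  have h2 : 1 + v / (1 - v) = (1 - v)⁻¹ := by field_simp; ring
  have h3 : v / (1 - v) / (1 - v)⁻¹ = v := by field_simp
  have hb : beta 1 θ = θ⁻¹ := by
    rw [beta, add_comm, Real.Gamma_add_one hθ.ne', Real.Gamma_one]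
    have := (Real.Gamma_pos_of_pos hθ).ne'
    field_simp
  simp only [h2, h3]
  rw [← mul_assoc, ← mul_assoc, ← ENNReal.ofReal_mul hθ.le, ← ENNReal.ofReal_mul (by positivity)]
  congr 2
  rw [hb, abs_of_pos (by positivity), Real.inv_rpow h1.le, Real.rpow_neg h1.le, inv_inv,
    Real.rpow_add_one h1.ne', Real.rpow_sub_one h1.ne']
  simp
  field_simp

/-- The distributional equation of the Dirichlet law: `v eᵢ + (1 - v) Y` has the law of `Y` when
`Y` is Dirichlet with parameters `a`, `v ∼ Be(1, θ)` with `θ = ∑ a`, and the index `i` is drawn with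
probabilities `a i / θ`, all independent. -/
lemma dirichletLaw_distributional_equation (ha : ∀ i, 0 ≤ a i) (hθ : 0 < ∑ i, a i)
    {f : (Fin n → ℝ) → ℝ≥0∞} (hf : Measurable f) :
    ∑ i, ENNReal.ofReal (a i) * ∫⁻ v, (∫⁻ y, f ((v : ℝ) • Pi.single i 1 + (1 - (v : ℝ)) • y)
        ∂dirichletLaw a) ∂betaLaw 1 (∑ i, a i) =
      ENNReal.ofReal (∑ i, a i) * ∫⁻ y, f y ∂dirichletLaw a := by
  have := fun i => isProbabilityMeasure_gammaLaw (ha i)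
  have := isProbabilityMeasure_dirichletLaw ha
  -- For independent `Z` with Gamma laws and `E ∼ Exp(1)`, the proportions of `Z + E eᵢ` are
  -- `v eᵢ + (1 - v) Y`, with `Y` the proportions of `Z`, `v = E / (E + S)` and `S = ∑ Z`.
  have h1 : ∀ i, ∫⁻ v, (∫⁻ y, f ((v : ℝ) • Pi.single i 1 + (1 - (v : ℝ)) • y)
        ∂dirichletLaw a) ∂betaLaw 1 (∑ i, a i) =
      ∫⁻ z, (∫⁻ e in Ioi 0, ENNReal.ofReal (Real.exp (-e)) *
        f (proportions (z + Pi.single i e))) ∂Measure.pi (fun i => gammaLaw (a i)) := by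
    intro i
    have hm : Measurable fun p : ℝ × (Fin n → ℝ) =>
        f (p.1 • Pi.single i 1 + (1 - p.1) • p.2) := by fun_prop
    have hm' : Measurable (Function.uncurry fun (u : ℝ) (y : Fin n → ℝ) =>
        f ((u / (1 + u)) • Pi.single i 1 + (1 - u / (1 + u)) • y)) := by
      unfold Function.uncurry
      fun_prop
    rw [lintegral_betaLaw_one hθ (F := fun v => ∫⁻ y, f (v • Pi.single i 1 + (1 - v) • y)
      ∂dirichletLaw a) hm.lintegral_prod_right', ← lintegral_const_mul' _ _ ENNReal.ofReal_ne_top]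
    have key := lintegral_pi_gammaLaw_tilt ha (k := fun u y =>
      f ((u / (1 + u)) • Pi.single i 1 + (1 - u / (1 + u)) • y)) hm'
    calc _ = _ := by
          refine setLIntegral_congr_fun measurableSet_Ioi fun u hu => ?_
          have hmu : Measurable fun y : Fin n → ℝ =>
            f ((u / (1 + u)) • Pi.single i 1 + (1 - u / (1 + u)) • y) := by fun_prop
          rw [mul_left_comm, ← lintegral_pi_gammaLaw_sum_mul ha hθ hmu]
      _ = _ := key.symm
      _ = _ := by
          refine lintegral_congr_ae ?_
          filter_upwards [ae_pi_gammaLaw_sum_pos ha hθ] with z hz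
          -- Substitute `e = S u` for the exponential variable, where `S` is the sum of the `z i`.
          conv_rhs => rw [lintegral_Ioi_comp_mul hz]
          refine setLIntegral_congr_fun measurableSet_Ioi fun u (hu : 0 < u) => ?_
          rw [mul_left_comm, mul_comm u]
          congr 3
          ext j
          have hs : ∑ j, (z + Pi.single i ((∑ i, z i) * u) : Fin n → ℝ) j =
              (∑ i, z i) * (1 + u) := by
            simp [Finset.sum_add_distrib]
            ring
          rw [proportions, hs]
          simp only [proportions, Pi.add_apply, Pi.smul_apply, smul_eq_mul]
          have : (Pi.single i ((∑ i, z i) * u) : Fin n → ℝ) j =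
              (∑ i, z i) * u * (Pi.single i 1 : Fin n → ℝ) j := by
            simp [Pi.single_apply]
          rw [this]
          field_simp
          ring
  simp_rw [h1]
  rw [← lintegral_pi_gammaLaw_sum_mul ha hθ hf]
  calc _ = ∑ i, ∫⁻ z, ENNReal.ofReal (z i) * f (proportions z)
        ∂Measure.pi (fun i => gammaLaw (a i)) :=
        Finset.sum_congr rfl fun i _ => lintegral_pi_gammaLaw_add_exp ha i
          (hf.comp measurable_proportions)
    _ = _ := by
        rw [← lintegral_finsetSum _ (by fun_prop)]
        refine lintegral_congr_ae ?_
        filter_upwards [ae_pi_gammaLaw_nonneg ha] with z hz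
        rw [ENNReal.ofReal_sum_of_nonneg fun i _ => hz i, Finset.sum_mul]

end GammaVectors

/-! ### Stick-breaking and independence of the sticks -/

@[fun_prop]
lemma continuous_stickBreaking (j : ℕ) : Continuous fun v : ℕ → I => stickBreaking v j := by
  unfold stickBreaking
  fun_prop

lemma coe_stickBreaking (v : ℕ → I) (j : ℕ) :
    (stickBreaking v j : ℝ) = v j * ∏ i ∈ Finset.range j, (1 - (v i : ℝ)) := by
  have : ∀ s : Finset ℕ, ((∏ i ∈ s, σ (v i) : I) : ℝ) = ∏ i ∈ s, (1 - (v i : ℝ)) := by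
    intro s
    induction s using Finset.induction_on with
    | empty => simp
    | insert i s hi ih => rw [Finset.prod_insert hi, Finset.prod_insert hi, Icc.coe_mul, ih,
        unitInterval.coe_symm_eq]
  rw [stickBreaking, Icc.coe_mul, this]

/-- The part of the stick left after `n` breaks is `∏ i < n, (1 - v i)`. -/
lemma sum_stickBreaking (v : ℕ → I) (n : ℕ) :
    ∑ j ∈ Finset.range n, (stickBreaking v j : ℝ) = 1 - ∏ i ∈ Finset.range n, (1 - (v i : ℝ)) := by
  induction n with
  | zero => simp
  | succ n ih =>
    rw [Finset.sum_range_succ, ih, coe_stickBreaking, Finset.prod_range_succ]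
    ring

section Recursion

variable {S : Type*} {m : ℕ}

/-- The vector obtained by breaking `n` sticks `v 0, …, v (n - 1)`, giving the `j`-th piece to the
category `e (x j)`, and the remaining mass to `y`.
Irreducible, to keep unification from unfolding it. -/
@[irreducible] noncomputable def stickPartial (e : S → Fin m → ℝ) (n : ℕ) (v : ℕ → I) (x : ℕ → S)
    (y : Fin m → ℝ) : Fin m → ℝ :=
  ∑ j ∈ Finset.range n, (stickBreaking v j : ℝ) • e (x j) +
    (∏ i ∈ Finset.range n, (1 - (v i : ℝ))) • y

lemma stickPartial_succ (e : S → Fin m → ℝ) (n : ℕ) (v : ℕ → I) (x : ℕ → S) (y : Fin m → ℝ) :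
    stickPartial e (n + 1) v x y =
      stickPartial e n v x ((v n : ℝ) • e (x n) + (1 - (v n : ℝ)) • y) := by
  simp only [stickPartial, Finset.sum_range_succ, Finset.prod_range_succ, coe_stickBreaking]
  module

lemma stickPartial_congr (e : S → Fin m → ℝ) {n : ℕ} {v v' : ℕ → I} {x x' : ℕ → S}
    (hv : ∀ i < n, v i = v' i) (hx : ∀ i < n, x i = x' i) (y : Fin m → ℝ) :
    stickPartial e n v x y = stickPartial e n v' x' y := by
  simp only [stickPartial, coe_stickBreaking]
  have hp : ∀ k ≤ n, ∏ i ∈ Finset.range k, (1 - (v i : ℝ)) =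
      ∏ i ∈ Finset.range k, (1 - (v' i : ℝ)) := fun k hk =>
    Finset.prod_congr rfl fun i hi => by rw [hv i ((Finset.mem_range.1 hi).trans_le hk)]
  congr 1
  · refine Finset.sum_congr rfl fun j hj => ?_
    have hj := Finset.mem_range.1 hj
    rw [hv j hj, hx j hj, hp j hj.le]
  · rw [hp n le_rfl]

lemma measurable_stickPartial [MeasurableSpace S] {e : S → Fin m → ℝ} (he : Measurable e) (n : ℕ)
    {X : Type*} [MeasurableSpace X] {v : X → ℕ → I} {x : X → ℕ → S} {y : X → Fin m → ℝ}
    (hv : Measurable v) (hx : Measurable x) (hy : Measurable y) :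
    Measurable fun p => stickPartial e n (v p) (x p) (y p) := by
  unfold stickPartial stickBreaking
  fun_prop

end Recursion

section Independence

variable {Ω : Type*} [MeasurableSpace Ω] {P : Measure Ω}

lemma lintegral_of_indepFun [IsProbabilityMeasure P] {β γ : Type*} [MeasurableSpace β]
    [MeasurableSpace γ] {X : Ω → β} {Y : Ω → γ} (h : IndepFun X Y P) (hX : Measurable X) (hY : Measurable Y)
    {F : β → γ → ℝ≥0∞}
    (hF : Measurable (Function.uncurry F)) :
    ∫⁻ ω, F (X ω) (Y ω) ∂P = ∫⁻ ω, (∫⁻ y, F (X ω) y ∂P.map Y) ∂P := by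
  have := Measure.isProbabilityMeasure_map (μ := P) hY.aemeasurable
  have h1 := (indepFun_iff_map_prod_eq_prod_map_map hX.aemeasurable hY.aemeasurable).1 h
  calc _ = ∫⁻ p, Function.uncurry F p ∂P.map fun ω => (X ω, Y ω) :=
        (lintegral_map hF (hX.prodMk hY)).symm
    _ = _ := by
        rw [h1, lintegral_prod _ hF.aemeasurable, lintegral_map hF.lintegral_prod_right' hX]
        rfl

/-- The first `n` terms of a sequence, extended by a constant. -/
def truncate {S : Type*} (s₀ : S) (n : ℕ) (x : ℕ → S) : ℕ → S := fun i => if i < n then x i else s₀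

lemma truncate_apply {S : Type*} (s₀ : S) {n i : ℕ} (hi : i < n) (x : ℕ → S) :
    truncate s₀ n x i = x i := if_pos hi

@[fun_prop]
lemma measurable_truncate {S : Type*} [MeasurableSpace S] (s₀ : S) (n : ℕ) :
    Measurable (truncate s₀ n) := by
  refine measurable_pi_iff.2 fun i => ?_
  unfold truncate
  split_ifs <;> fun_prop

lemma indepFun_truncate_of_iIndepFun {S : Type*} [MeasurableSpace S] {ξ : ℕ → Ω → S}
    (h : iIndepFun ξ P) (hξ : ∀ i, Measurable (ξ i)) (s₀ : S) (n : ℕ) :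
    IndepFun (fun ω => truncate s₀ n fun i => ξ i ω) (ξ n) P := by
  have h1 := h.indepFun_finset (Finset.range n) {n} (by simp) hξ
  have hext : Measurable fun (g : Finset.range n → S) (i : ℕ) =>
      if hi : i ∈ Finset.range n then g ⟨i, hi⟩ else s₀ := by
    refine measurable_pi_iff.2 fun i => ?_
    split_ifs <;> fun_prop
  convert h1.comp hext (measurable_pi_apply (⟨n, by simp⟩ : ({n} : Finset ℕ))) using 1
  · ext ω i
    simp [truncate]
  · rfl

/-- For `κ = 0` the transition kernel is constant, so each stick is independent of its predecessors
and has the initial law. -/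
lemma IsBetaChain.indepFun_truncate [IsProbabilityMeasure P] {α θ : ℝ} {V : ℕ → Ω → I}
    (hα : 0 < α) (hθ : 0 < θ)
    (h : IsBetaChain 0 α θ V P) (n : ℕ) :
    IndepFun (fun ω => truncate 0 n fun i => V i ω) (V n) P ∧ P.map (V n) = betaLaw α θ := by
  have := isProbabilityMeasure_betaLaw hα hθ
  obtain _ | n := n
  · refine ⟨?_, h.initial.map_eq⟩
    have h0 : (fun ω => truncate 0 0 fun i => V i ω) = fun _ _ => 0 := by
      ext ω i
      simp [truncate]
    rw [h0]
    exact indepFun_const_left _ _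
  have hker : (betaChainKernel 0 α θ).comap
      (fun h : Finset.Iic n → I => h ⟨n, Finset.mem_Iic.mpr le_rfl⟩) (by fun_prop) =
      Kernel.const _ (betaLaw α θ) := by
    ext x s
    simp [betaChainKernel]
  have ht := h.transition n
  rw [hker] at ht
  have hlaw := ht.hasLaw_of_const.map_eq
  have hmH : Measurable fun ω (i : Finset.Iic n) => V i ω :=
    measurable_pi_iff.2 fun i => h.measurable i
  have := Measure.isProbabilityMeasure_map (μ := P) hmH.aemeasurable
  refine ⟨?_, hlaw⟩
  have hind : IndepFun (fun ω (i : Finset.Iic n) => V i ω) (V (n + 1)) P := by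
    rw [indepFun_iff_map_prod_eq_prod_map_map hmH.aemeasurable (h.measurable _).aemeasurable, hlaw]
    exact ht.map_eq.trans Measure.compProd_const
  have hext : Measurable fun (g : Finset.Iic n → I) (i : ℕ) =>
      if hi : i ∈ Finset.Iic n then g ⟨i, hi⟩ else 0 := by
    refine measurable_pi_iff.2 fun i => ?_
    split_ifs <;> fun_prop
  convert hind.comp hext measurable_id using 1
  · ext ω i
    simp [truncate]
  · rfl

end Independence

/-! ### Finitely many sticks and a Dirichlet remainder -/

section Dirichlet

variable {S : Type*} {m : ℕ} {A : Fin m → Set S}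

/-- The indicator vector of the cell of a point with respect to a family of sets. -/
noncomputable def cellVector (A : Fin m → Set S) (x : S) : Fin m → ℝ :=
  fun i => (A i).indicator 1 x

lemma cellVector_of_mem (hd : Pairwise (Function.onFun Disjoint A)) {i : Fin m} {x : S}
    (hx : x ∈ A i) : cellVector A x = Pi.single i 1 := by
  ext j
  rcases eq_or_ne j i with rfl | hj
  · simp [cellVector, hx]
  · simp [cellVector, hj, (hd hj.symm).notMem_of_mem_left hx]

variable [MeasurableSpace S]

lemma measurable_cellVector (hA : ∀ i, MeasurableSet (A i)) : Measurable (cellVector A) :=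
  measurable_pi_iff.2 fun i => measurable_one.indicator (hA i)

lemma lintegral_cellVector {P₀ : Measure S} (hA : ∀ i, MeasurableSet (A i))
    (hd : Pairwise (Function.onFun Disjoint A)) (hu : (⋃ i, A i) = univ)
    (F : (Fin m → ℝ) → ℝ≥0∞) :
    ∫⁻ x, F (cellVector A x) ∂P₀ = ∑ i, P₀ (A i) * F (Pi.single i 1) := by
  rw [← setLIntegral_univ, ← hu, lintegral_iUnion hA hd, tsum_fintype]
  refine Finset.sum_congr rfl fun i _ => ?_
  rw [setLIntegral_congr_fun (hA i) (g := fun _ => F (Pi.single i 1))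
    fun x hx => by rw [cellVector_of_mem hd hx], setLIntegral_const, mul_comm]

lemma sum_measureReal_partition {P₀ : Measure S} [IsProbabilityMeasure P₀]
    (hA : ∀ i, MeasurableSet (A i))
    (hd : Pairwise (Function.onFun Disjoint A)) (hu : (⋃ i, A i) = univ) (θ : ℝ) :
    ∑ i, θ * P₀.real (A i) = θ := by
  rw [← Finset.mul_sum, ← measureReal_iUnion_fintype hd hA, hu, probReal_univ, mul_one]

/-- The Dirichlet law is invariant under `y ↦ v • e + (1 - v) • y`, with `v ∼ Be(1, θ)` and `e` the
cell vector of a point drawn from `P₀`. -/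
lemma lintegral_dirichletLaw_invariant {P₀ : Measure S} [IsProbabilityMeasure P₀]
    (hA : ∀ i, MeasurableSet (A i))
    (hd : Pairwise (Function.onFun Disjoint A)) (hu : (⋃ i, A i) = univ) {θ : ℝ} (hθ : 0 < θ)
    {g : (Fin m → ℝ) → ℝ≥0∞} (hg : Measurable g) :
    ∫⁻ v, (∫⁻ s, (∫⁻ y, g ((v : ℝ) • cellVector A s + (1 - (v : ℝ)) • y)
      ∂dirichletLaw fun i => θ * P₀.real (A i)) ∂P₀) ∂betaLaw 1 θ =
      ∫⁻ y, g y ∂dirichletLaw fun i => θ * P₀.real (A i) := by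
  set a : Fin m → ℝ := fun i => θ * P₀.real (A i) with ha_def
  have ha : ∀ i, 0 ≤ a i := fun i => by positivity
  have hsum : ∑ i, a i = θ := sum_measureReal_partition hA hd hu θ
  have key := dirichletLaw_distributional_equation ha (by rwa [hsum]) hg
  have := isProbabilityMeasure_dirichletLaw ha
  rw [hsum] at key
  have hpos : ENNReal.ofReal θ ≠ 0 := by simpa using hθ
  refine (ENNReal.mul_right_inj hpos ENNReal.ofReal_ne_top).1 (Eq.trans ?_ key)
  have h1 : ∀ v : I, ∫⁻ s, (∫⁻ y, g ((v : ℝ) • cellVector A s + (1 - (v : ℝ)) • y)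
      ∂dirichletLaw a) ∂P₀ = ∑ i, P₀ (A i) *
        ∫⁻ y, g ((v : ℝ) • Pi.single i 1 + (1 - (v : ℝ)) • y) ∂dirichletLaw a := fun v =>
    lintegral_cellVector hA hd hu fun c => ∫⁻ y, g ((v : ℝ) • c + (1 - (v : ℝ)) • y)
      ∂dirichletLaw a
  have hm : ∀ i, Measurable fun v : I =>
      ∫⁻ y, g ((v : ℝ) • Pi.single i 1 + (1 - (v : ℝ)) • y) ∂dirichletLaw a := by
    intro i
    have : Measurable fun p : I × (Fin m → ℝ) =>
        g ((p.1 : ℝ) • Pi.single i 1 + (1 - (p.1 : ℝ)) • p.2) := by fun_prop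
    exact this.lintegral_prod_right'
  simp_rw [h1]
  rw [lintegral_finsetSum _ fun i _ => (hm i).const_mul _, Finset.mul_sum]
  refine Finset.sum_congr rfl fun i _ => ?_
  rw [lintegral_const_mul _ (hm i), ← mul_assoc, ha_def, ENNReal.ofReal_mul hθ.le,
    ofReal_measureReal]

variable {Ω : Type*} [MeasurableSpace Ω] {P : Measure Ω} [IsProbabilityMeasure P]

/-- For independent pairs `(X, Y)` and `(X', Y')`, the variables `Y` and `Y'` may be integrated out
first. -/
lemma lintegral_lintegral_of_indepFun {β γ β' γ' : Type*} [MeasurableSpace β] [MeasurableSpace γ]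
    [MeasurableSpace β'] [MeasurableSpace γ'] {X : Ω → β} {Y : Ω → γ} {X' : Ω → β'} {Y' : Ω → γ'}
    (h : IndepFun X Y P) (h' : IndepFun X' Y' P) (hX : Measurable X) (hY : Measurable Y)
    (hX' : Measurable X') (hY' : Measurable Y') {K : β → γ → β' → γ' → ℝ≥0∞}
    (hK : Measurable fun p : β × γ × β' × γ' => K p.1 p.2.1 p.2.2.1 p.2.2.2) :
    ∫⁻ ω, (∫⁻ ω', K (X ω) (Y ω) (X' ω') (Y' ω') ∂P) ∂P =
      ∫⁻ ω, (∫⁻ ω', (∫⁻ y, (∫⁻ y', K (X ω) y (X' ω') y' ∂P.map Y') ∂P.map Y) ∂P) ∂P := by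
  have := Measure.isProbabilityMeasure_map (μ := P) hY.aemeasurable
  have := Measure.isProbabilityMeasure_map (μ := P) hY'.aemeasurable
  have hm : Measurable fun q : ((β × γ) × Ω) × γ' => K q.1.1.1 q.1.1.2 (X' q.1.2) q.2 :=
    hK.comp (f := fun q : ((β × γ) × Ω) × γ' => (q.1.1.1, q.1.1.2, X' q.1.2, q.2)) (by fun_prop)
  calc _ = ∫⁻ ω, (∫⁻ ω', (∫⁻ y', K (X ω) (Y ω) (X' ω') y' ∂P.map Y') ∂P) ∂P := by
        refine lintegral_congr fun ω => ?_
        have hmω : Measurable fun p : β' × γ' => K (X ω) (Y ω) p.1 p.2 :=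
          hK.comp (f := fun p : β' × γ' => (X ω, Y ω, p.1, p.2)) (by fun_prop)
        exact lintegral_of_indepFun h' hX' hY' (F := K (X ω) (Y ω)) hmω
    _ = ∫⁻ ω, (∫⁻ y, (∫⁻ ω', (∫⁻ y', K (X ω) y (X' ω') y' ∂P.map Y') ∂P) ∂P.map Y) ∂P :=
        lintegral_of_indepFun h hX hY
          (F := fun x y => ∫⁻ ω', (∫⁻ y', K x y (X' ω') y' ∂P.map Y') ∂P)
          hm.lintegral_prod_right'.lintegral_prod_right'
    _ = _ := by
        refine lintegral_congr fun ω => ?_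
        have hmω : Measurable fun q : γ × Ω => ∫⁻ y', K (X ω) q.1 (X' q.2) y' ∂P.map Y' :=
          hm.lintegral_prod_right'.comp (f := fun q : γ × Ω => ((X ω, q.1), q.2)) (by fun_prop)
        exact lintegral_lintegral_swap hmω.aemeasurable

/-- Breaking `n` independent `Be(1, θ)` sticks and giving the remaining mass to an independent
Dirichlet vector yields the Dirichlet law, whatever `n`. The sticks `V` and the atoms `ξ` are
evaluated at independent points of `Ω`: a species sampling process has atoms independent of the
weights, but not necessarily of the sticks, and only the joint law of weights and atoms matters. -/
lemma lintegral_stickPartial {P₀ : Measure S} [IsProbabilityMeasure P₀]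
    (hA : ∀ i, MeasurableSet (A i))
    (hd : Pairwise (Function.onFun Disjoint A)) (hu : (⋃ i, A i) = univ) {θ : ℝ} (hθ : 0 < θ)
    {V : ℕ → Ω → I} (hV : IsBetaChain 0 1 θ V P) {ξ : ℕ → Ω → S} (hξ : ∀ i, Measurable (ξ i))
    (hξl : ∀ i, HasLaw (ξ i) P₀ P) (hξi : iIndepFun ξ P)
    {f : (Fin m → ℝ) → ℝ≥0∞} (hf : Measurable f) (n : ℕ) :
    ∫⁻ ω, (∫⁻ ω', (∫⁻ y, f (stickPartial (cellVector A) n (fun i => V i ω) (fun i => ξ i ω') y)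
      ∂dirichletLaw fun i => θ * P₀.real (A i)) ∂P) ∂P =
      ∫⁻ y, f y ∂dirichletLaw fun i => θ * P₀.real (A i) := by
  have hinv := fun g hg => lintegral_dirichletLaw_invariant (P₀ := P₀) hA hd hu hθ (g := g) hg
  have := isProbabilityMeasure_dirichletLaw (a := fun i => θ * P₀.real (A i))
    fun i => by positivity
  generalize dirichletLaw (fun i => θ * P₀.real (A i)) = D at *
  have he := measurable_cellVector hA
  obtain ⟨s₀⟩ : Nonempty S := nonempty_of_isProbabilityMeasure P₀
  induction n with
  | zero => simp [stickPartial]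
  | succ n ih =>
    rw [← ih]
    let K : (ℕ → I) → I → (ℕ → S) → S → ℝ≥0∞ := fun h v x s =>
      ∫⁻ y, f (stickPartial (cellVector A) n h x ((v : ℝ) • cellVector A s + (1 - (v : ℝ)) • y)) ∂D
    have hK : Measurable fun p : (ℕ → I) × I × (ℕ → S) × S => K p.1 p.2.1 p.2.2.1 p.2.2.2 := by
      have : Measurable fun q : ((ℕ → I) × I × (ℕ → S) × S) × (Fin m → ℝ) =>
          f (stickPartial (cellVector A) n q.1.1 q.1.2.2.1 ((q.1.2.1 : ℝ) • cellVector A q.1.2.2.2 +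
            (1 - (q.1.2.1 : ℝ)) • q.2)) := by
        exact hf.comp (measurable_stickPartial he n (by fun_prop) (by fun_prop) (by fun_prop))
      exact this.lintegral_prod_right'
    -- The first `n` sticks and atoms, on which the first `n` pieces depend.
    obtain ⟨T, hTdef⟩ : ∃ T : Ω → ℕ → I, T = fun ω => truncate 0 n fun i => V i ω := ⟨_, rfl⟩
    obtain ⟨T', hTdef'⟩ : ∃ T' : Ω → ℕ → S, T' = fun ω => truncate s₀ n fun i => ξ i ω := ⟨_, rfl⟩
    have hT : Measurable T := hTdef ▸
      (measurable_truncate 0 n).comp (measurable_pi_iff.2 hV.measurable)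
    have hT' : Measurable T' := hTdef' ▸
      (measurable_truncate s₀ n).comp (measurable_pi_iff.2 hξ)
    obtain ⟨hind, hlaw⟩ := hV.indepFun_truncate one_pos hθ n
    have hind' := indepFun_truncate_of_iIndepFun hξi hξ s₀ n
    rw [← hTdef] at hind
    rw [← hTdef'] at hind'
    have htrunc : ∀ ω ω' y, stickPartial (cellVector A) n (fun i => V i ω) (fun i => ξ i ω') y =
        stickPartial (cellVector A) n (T ω) (T' ω') y := by
      rw [hTdef, hTdef']
      exact fun ω ω' y => stickPartial_congr _
        (fun i hi => (truncate_apply 0 hi fun i => V i ω).symm)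
        (fun i hi => (truncate_apply s₀ hi fun i => ξ i ω').symm) y
    have hstep := lintegral_lintegral_of_indepFun hind hind' hT (hV.measurable n) hT' (hξ n)
      (K := K) hK
    rw [hlaw, (hξl n).map_eq] at hstep
    simp_rw [stickPartial_succ, htrunc]
    refine hstep.trans (lintegral_congr fun ω => lintegral_congr fun ω' => ?_)
    have hg : Measurable fun y => f (stickPartial (cellVector A) n (T ω) (T' ω') y) :=
      hf.comp (measurable_stickPartial he n measurable_const measurable_const measurable_id)
    exact hinv _ hg

end Dirichlet

/-! ### The Dirichlet process -/

section Limit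

variable {S : Type*} {m : ℕ} {A : Fin m → Set S}

/-- The masses of the sets `A i` under `∑ j, w j • δ_{x j}`. Irreducible, to keep unification from
unfolding it. -/
@[irreducible] noncomputable def massVector (A : Fin m → Set S) (w : ℕ → I) (x : ℕ → S) :
    Fin m → ℝ :=
  fun i => (∑' j, ENNReal.ofReal (w j) * (A i).indicator 1 (x j)).toReal

/-- When the weights sum to one, the influence of the remainder `y` vanishes in the limit. -/
lemma tendsto_stickPartial {v : ℕ → I} (hv : ∑' j, ENNReal.ofReal (stickBreaking v j) = 1)
    (x : ℕ → S) (y : Fin m → ℝ) :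
    Tendsto (fun n => stickPartial (cellVector A) n v x y) atTop
      (𝓝 (massVector A (stickBreaking v) x)) := by
  have hw : Tendsto (fun n => ∑ j ∈ Finset.range n, (stickBreaking v j : ℝ)) atTop (𝓝 1) := by
    have h := ENNReal.hasSum_toReal (f := fun j => ENNReal.ofReal (stickBreaking v j))
      (by simp [hv])
    rw [← ENNReal.tsum_toReal_eq (fun _ => ENNReal.ofReal_ne_top), hv] at h
    simpa [ENNReal.toReal_ofReal, unitInterval.nonneg] using h.tendsto_sum_nat
  have hR : Tendsto (fun n => ∏ i ∈ Finset.range n, (1 - (v i : ℝ))) atTop (𝓝 0) := by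
    have := hw.const_sub 1
    simpa [sum_stickBreaking] using this
  refine tendsto_pi_nhds.2 fun i => ?_
  have hle : ∀ j, ENNReal.ofReal (stickBreaking v j) * (A i).indicator 1 (x j) ≤
      ENNReal.ofReal (stickBreaking v j) := fun j => by
    refine mul_le_of_le_one_right' (indicator_le_self' (by simp) _)
  have hfin : ∑' j, ENNReal.ofReal (stickBreaking v j) * (A i).indicator 1 (x j) ≠ ∞ :=
    ((ENNReal.tsum_le_tsum hle).trans_lt (by simp [hv])).ne
  have hs := (ENNReal.hasSum_toReal hfin).tendsto_sum_nat
  rw [← ENNReal.tsum_toReal_eq (ENNReal.ne_top_of_tsum_ne_top hfin)] at hs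
  have key := hs.add (hR.mul_const (y i))
  rw [zero_mul, add_zero] at key
  rw [massVector]
  refine key.congr fun n => ?_
  simp only [stickPartial, Pi.add_apply, Finset.sum_apply, Pi.smul_apply, smul_eq_mul]
  congr 1
  refine Finset.sum_congr rfl fun j _ => ?_
  rw [ENNReal.toReal_mul, ENNReal.toReal_ofReal (unitInterval.nonneg _), cellVector]
  congr 1
  by_cases h : x j ∈ A i <;> simp [h]

variable [MeasurableSpace S]

lemma measurable_massVector (hA : ∀ i, MeasurableSet (A i)) {X : Type*} [MeasurableSpace X]
    {w : X → ℕ → I} {x : X → ℕ → S} (hw : Measurable w) (hx : Measurable x) :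
    Measurable fun q => massVector A (w q) (x q) := by
  refine measurable_pi_iff.2 fun i => ?_
  simp only [massVector]
  refine (Measurable.tsum fun j => ?_).ennreal_toReal
  have : Measurable ((A i).indicator (1 : S → ℝ≥0∞)) := measurable_one.indicator (hA i)
  fun_prop

lemma measure_sum_dirac_apply (w : ℕ → I) (x : ℕ → S) {B : Set S} (hB : MeasurableSet B) :
    (Measure.sum fun j => ENNReal.ofReal (w j : ℝ) • Measure.dirac (x j)) B =
      ∑' j, ENNReal.ofReal (w j) * B.indicator 1 (x j) := by
  simp [Measure.sum_apply _ hB, Measure.dirac_apply' _ hB]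

/-- The weights sum to one as soon as the weighted sum of Dirac masses is a probability measure. -/
lemma tsum_weights_eq_one {w : ℕ → I} {x : ℕ → S} {ν : ProbabilityMeasure S}
    (h : (ν : Measure S) = Measure.sum fun j => ENNReal.ofReal (w j : ℝ) • Measure.dirac (x j)) :
    ∑' j, ENNReal.ofReal (w j) = 1 := by
  have := congrArg (fun ν : Measure S => ν univ) h
  simp only [measure_univ, measure_sum_dirac_apply _ _ MeasurableSet.univ] at this
  simpa using this.symm

/-- The masses of the cells under the stick-breaking measure have the Dirichlet law, the sticks and
the atoms being evaluated at independent points of `Ω`. -/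
lemma lintegral_massVector_stickBreaking {Ω : Type*} [MeasurableSpace Ω] {P : Measure Ω}
    [IsProbabilityMeasure P] {P₀ : Measure S} [IsProbabilityMeasure P₀]
    (hA : ∀ i, MeasurableSet (A i)) (hd : Pairwise (Function.onFun Disjoint A))
    (hu : (⋃ i, A i) = univ) {θ : ℝ} (hθ : 0 < θ)
    {V : ℕ → Ω → I} (hV : IsBetaChain 0 1 θ V P) {ξ : ℕ → Ω → S} (hξ : ∀ i, Measurable (ξ i))
    (hξl : ∀ i, HasLaw (ξ i) P₀ P) (hξi : iIndepFun ξ P)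
    (hone : ∀ᵐ ω ∂P, ∑' j, ENNReal.ofReal (stickBreaking (fun i => V i ω) j) = 1)
    (f : BoundedContinuousFunction (Fin m → ℝ) NNReal) :
    ∫⁻ ω, (∫⁻ ω', (f (massVector A (stickBreaking fun i => V i ω) fun j => ξ j ω') : ℝ≥0∞) ∂P) ∂P =
      ∫⁻ y, (f y : ℝ≥0∞) ∂dirichletLaw fun i => θ * P₀.real (A i) := by
  have hD := isProbabilityMeasure_dirichletLaw (a := fun i => θ * P₀.real (A i))
    fun i => by positivity
  have hf : Measurable fun y => (f y : ℝ≥0∞) :=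
    f.continuous.measurable.coe_nnreal_ennreal
  have hlim := fun n => lintegral_stickPartial hA hd hu hθ hV hξ hξl hξi hf n
  generalize dirichletLaw (fun i => θ * P₀.real (A i)) = D at *
  have hW : Measurable fun ω => stickBreaking fun i => V i ω :=
    measurable_pi_iff.2 fun j => (continuous_stickBreaking j).measurable.comp
      (measurable_pi_iff.2 hV.measurable)
  have hξ' : Measurable fun ω j => ξ j ω := measurable_pi_iff.2 hξ
  have hV' : Measurable fun ω i => V i ω := measurable_pi_iff.2 hV.measurable
  have hW1 : Measurable fun q : Ω × Ω => stickBreaking fun i => V i q.1 := hW.comp measurable_fst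
  have hξ2 : Measurable fun (q : Ω × Ω) j => ξ j q.2 := hξ'.comp measurable_snd
  have hm : Measurable fun q : Ω × Ω =>
      (f (massVector A (stickBreaking fun i => V i q.1) fun j => ξ j q.2) : ℝ≥0∞) := by
    simpa only [Function.comp_def] using hf.comp (measurable_massVector hA hW1 hξ2)
  have hmn : ∀ n, Measurable fun q : (Ω × Ω) × (Fin m → ℝ) =>
      (f (stickPartial (cellVector A) n (fun i => V i q.1.1) (fun i => ξ i q.1.2) q.2) :
        ℝ≥0∞) := fun n => by
    have h1 : Measurable fun (q : (Ω × Ω) × (Fin m → ℝ)) i => V i q.1.1 :=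
      hV'.comp (measurable_fst.comp measurable_fst)
    have h2 : Measurable fun (q : (Ω × Ω) × (Fin m → ℝ)) i => ξ i q.1.2 :=
      hξ'.comp (measurable_snd.comp measurable_fst)
    simpa only [Function.comp_def] using
      hf.comp (measurable_stickPartial (measurable_cellVector hA) n h1 h2 measurable_snd)
  have hconst : ∀ n, ∫⁻ q, (f (stickPartial (cellVector A) n (fun i => V i q.1.1)
      (fun i => ξ i q.1.2) q.2) : ℝ≥0∞) ∂(P.prod P).prod D = ∫⁻ y, (f y : ℝ≥0∞) ∂D := by
    intro n
    rw [lintegral_prod _ (hmn n).aemeasurable,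
      lintegral_prod _ (hmn n).lintegral_prod_right'.aemeasurable, ← hlim n]
  have h1 : ∀ᵐ q : (Ω × Ω) × (Fin m → ℝ) ∂(P.prod P).prod D,
      ∑' j, ENNReal.ofReal (stickBreaking (fun i => V i q.1.1) j) = 1 :=
    (Measure.quasiMeasurePreserving_fst.comp Measure.quasiMeasurePreserving_fst).ae hone
  have hT := tendsto_lintegral_of_dominated_convergence (μ := (P.prod P).prod D)
    (f := fun q => (f (massVector A (stickBreaking fun i => V i q.1.1) fun j => ξ j q.1.2) : ℝ≥0∞))
    (fun _ => (nndist f 0 : ℝ≥0∞)) hmn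
    (fun n => ae_of_all _ fun q =>
      ENNReal.coe_le_coe.2 (BoundedContinuousFunction.NNReal.upper_bound f _)) (by simp) (by
      filter_upwards [h1] with q hq
      exact ((ENNReal.continuous_coe.comp f.continuous).tendsto _).comp
        (tendsto_stickPartial hq _ _))
  have hm1 : Measurable fun q : (Ω × Ω) × (Fin m → ℝ) =>
      (f (massVector A (stickBreaking fun i => V i q.1.1) fun j => ξ j q.1.2) : ℝ≥0∞) :=
    hm.comp measurable_fst
  rw [← tendsto_nhds_unique hT (tendsto_const_nhds.congr fun n => (hconst n).symm),
    lintegral_prod _ hm1.aemeasurable]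
  simp only [lintegral_const, measure_univ, mul_one]
  rw [lintegral_prod _ hm.aemeasurable]

/-- With independent `Be(1, θ)` sticks, stick-breaking yields the Dirichlet process. -/
theorem isDirichletProcess_of_isBBSBPrior {Ω : Type*} [MeasurableSpace Ω] {P : Measure Ω}
    [IsProbabilityMeasure P] {P₀ : Measure S} [IsProbabilityMeasure P₀] {θ : ℝ} (hθ : 0 < θ)
    {μ : Ω → ProbabilityMeasure S} (hμ : IsBBSBPrior 0 1 θ P₀ μ P) :
    IsDirichletProcess θ P₀ μ P := by
  obtain ⟨V, hV, hμm, ξ, hξ, hξl, hξi, hWξ, hsum⟩ := hμ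
  refine ⟨hμm, fun m A hA hd hu => ?_⟩
  have hXm : Measurable fun ω i => (μ ω : Measure S).real (A i) :=
    measurable_pi_iff.2 fun i =>
      ((Measure.measurable_coe (hA i)).comp (measurable_subtype_coe.comp hμm)).ennreal_toReal
  have hW : Measurable fun ω => stickBreaking fun i => V i ω :=
    measurable_pi_iff.2 fun j => (continuous_stickBreaking j).measurable.comp
      (measurable_pi_iff.2 hV.measurable)
  have hξ' : Measurable fun ω j => ξ j ω := measurable_pi_iff.2 hξ
  have hone : ∀ᵐ ω ∂P, ∑' j, ENNReal.ofReal (stickBreaking (fun i => V i ω) j) = 1 := by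
    filter_upwards [hsum] with ω hω using tsum_weights_eq_one hω
  have key := lintegral_massVector_stickBreaking hA hd hu hθ hV hξ hξl hξi hone
  refine ⟨hXm.aemeasurable, ?_⟩
  have hae : (fun ω i => (μ ω : Measure S).real (A i)) =ᵐ[P] fun ω =>
      massVector A (stickBreaking fun i => V i ω) fun j => ξ j ω := by
    filter_upwards [hsum] with ω hω
    ext i
    rw [massVector, measureReal_def, hω, measure_sum_dirac_apply _ _ (hA i)]
  change IndepFun (fun ω => stickBreaking fun i => V i ω) _ P at hWξ
  rw [Measure.map_congr hae]
  have hY : Measurable fun ω => massVector A (stickBreaking fun i => V i ω)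
      fun j => ξ j ω := measurable_massVector hA hW hξ'
  have := Measure.isProbabilityMeasure_map (μ := P) hY.aemeasurable
  refine ext_of_forall_lintegral_eq_of_IsFiniteMeasure fun f => ?_
  have hf : Measurable fun y => (f y : ℝ≥0∞) :=
    f.continuous.measurable.coe_nnreal_ennreal
  have hF : Measurable fun p : (ℕ → I) × (ℕ → S) => (f (massVector A p.1 p.2) : ℝ≥0∞) := by
    simpa only [Function.comp_def] using
      hf.comp (measurable_massVector hA measurable_fst measurable_snd)
  have hind := lintegral_of_indepFun hWξ hW hξ'
    (F := fun w x => (f (massVector A w x) : ℝ≥0∞)) hF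
  rw [lintegral_map hf hY, ← key f]
  refine hind.trans (lintegral_congr fun ω => ?_)
  have hFω : Measurable fun x => (f (massVector A (stickBreaking fun i => V i ω) x) : ℝ≥0∞) :=
    hF.comp (measurable_const.prodMk measurable_id)
  exact lintegral_map hFω hξ'

end Limit

/-! ### Moments of the Beta distribution and of the transition kernel -/

section Moments

lemma beta_add_one_div {b c : ℝ} (hb : 0 < b) (hc : 0 < c) :
    beta (b + 1) c = b / (b + c) * beta b c := by
  have h := (Real.Gamma_pos_of_pos (add_pos hb hc)).ne'
  rw [beta, beta, show b + 1 + c = b + c + 1 by ring, Real.Gamma_add_one hb.ne',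
    Real.Gamma_add_one (by positivity)]
  field_simp

/-- Size biasing turns `Be(b, c)` into `Be(b + 1, c)`. -/
lemma lintegral_betaLaw_mul {b c : ℝ} (hb : 0 < b) (hc : 0 < c) {F : ℝ → ℝ≥0∞}
    (hF : Measurable F) :
    ∫⁻ v, ENNReal.ofReal (v : ℝ) * F v ∂betaLaw b c =
      ENNReal.ofReal (b / (b + c)) * ∫⁻ v, F v ∂betaLaw (b + 1) c := by
  rw [lintegral_betaLaw (F := fun v => ENNReal.ofReal v * F v) (by fun_prop), lintegral_betaLaw hF,
    ← lintegral_const_mul _ (by fun_prop)]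
  refine setLIntegral_congr_fun measurableSet_Ioo fun x hx => ?_
  have h0 : 0 < x := hx.1
  have h1 : 0 < 1 - x := by linarith [hx.2]
  have hβ := beta_pos hb hc
  rw [← mul_assoc, ← mul_assoc, ← ENNReal.ofReal_mul (by positivity),
    ← ENNReal.ofReal_mul (by positivity)]
  congr 2
  rw [beta_add_one_div hb hc, add_sub_cancel_right, Real.rpow_sub_one h0.ne']
  field_simp

lemma integral_betaLaw {b c : ℝ} (hb : 0 < b) (hc : 0 < c) :
    ∫ v, (v : ℝ) ∂betaLaw b c = b / (b + c) := by
  have := isProbabilityMeasure_betaLaw (a := b + 1) (by positivity) hc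
  have h := lintegral_betaLaw_mul hb hc (F := fun _ => 1) measurable_const
  simp only [mul_one, lintegral_const, measure_univ] at h
  rw [integral_eq_lintegral_of_nonneg_ae (ae_of_all _ fun v => v.2.1) (by fun_prop), h,
    ENNReal.toReal_ofReal (by positivity)]

lemma integral_betaLaw_sq {b c : ℝ} (hb : 0 < b) (hc : 0 < c) :
    ∫ v, (v : ℝ) ^ 2 ∂betaLaw b c = b / (b + c) * ((b + 1) / (b + c + 1)) := by
  have := isProbabilityMeasure_betaLaw (a := b + 1 + 1) (by positivity) hc
  have h := lintegral_betaLaw_mul hb hc (F := fun v => ENNReal.ofReal v) (by fun_prop)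
  have h' := lintegral_betaLaw_mul (b := b + 1) (by positivity) hc (F := fun _ => 1)
    measurable_const
  simp only [mul_one, lintegral_const, measure_univ] at h'
  rw [integral_eq_lintegral_of_nonneg_ae (ae_of_all _ fun v => by positivity) (by fun_prop)]
  have : ∀ v : I, ENNReal.ofReal ((v : ℝ) ^ 2) = ENNReal.ofReal v * ENNReal.ofReal v := fun v => by
    rw [sq, ENNReal.ofReal_mul v.2.1]
  simp_rw [this]
  rw [h, h', ← ENNReal.ofReal_mul (by positivity), ENNReal.toReal_ofReal (by positivity),
    show b + 1 + c = b + c + 1 by ring]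

lemma integrable_of_continuous_unitInterval {ν : Measure I} [IsFiniteMeasure ν] {F : I → ℝ}
    (hF : Continuous F) : Integrable F ν :=
  (BoundedContinuousFunction.mkOfCompact ⟨F, hF⟩).integrable ν

/-- The mean square distance of `Be(α + x, θ + κ - x)` from `x / κ` is of order `1 / κ`. -/
lemma integral_betaLaw_sub_sq_le {α θ : ℝ} (hα : 0 < α) (hθ : 0 < θ) {κ x : ℕ} (hκ : 0 < κ)
    (hx : x ≤ κ) :
    ∫ y, ((y : ℝ) - x / κ) ^ 2 ∂betaLaw (α + x) (θ + κ - x) ≤ (1 + α + θ) / κ := by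
  have hx' : (x : ℝ) ≤ κ := by exact_mod_cast hx
  have hx0 : (0 : ℝ) ≤ x := by positivity
  have hk : (0 : ℝ) < κ := by exact_mod_cast hκ
  have hb : 0 < α + x := by positivity
  have hc : 0 < θ + κ - x := by linarith
  have := isProbabilityMeasure_betaLaw hb hc
  have h1 : ∫ y, ((y : ℝ) - x / κ) ^ 2 ∂betaLaw (α + x) (θ + κ - x) =
      ∫ y, (y : ℝ) ^ 2 ∂betaLaw (α + x) (θ + κ - x) -
        2 * (x / κ) * ∫ y, (y : ℝ) ∂betaLaw (α + x) (θ + κ - x) + (x / κ) ^ 2 := by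
    rw [← integral_const_mul, ← integral_sub
      (integrable_of_continuous_unitInterval (by fun_prop))
      (integrable_of_continuous_unitInterval (by fun_prop))]
    have : (x / κ : ℝ) ^ 2 = ∫ _, (x / κ : ℝ) ^ 2 ∂betaLaw (α + x) (θ + κ - x) := by simp
    rw [this, ← integral_add (integrable_of_continuous_unitInterval (by fun_prop))
      (integrable_of_continuous_unitInterval (by fun_prop))]
    congr 1 with y
    ring
  rw [h1, integral_betaLaw hb hc, integral_betaLaw_sq hb hc]
  set N : ℝ := α + θ + κ with hN
  have hN0 : 0 < N := by positivity
  rw [show α + x + (θ + κ - x) = N by rw [hN]; ring]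
  set t : ℝ := x / κ with ht
  have ht0 : 0 ≤ t := by positivity
  have ht1 : t ≤ 1 := (div_le_one hk).2 hx'
  have hxt : (x : ℝ) = t * κ := by rw [ht]; field_simp
  set p : ℝ := (α + x) / N with hp
  have hp0 : 0 ≤ p := by positivity
  have hp1 : p ≤ 1 := (div_le_one hN0).2 (by rw [hN]; linarith)
  have hpN : α + x = p * N := by rw [hp]; field_simp
  -- bias and variance, with `p` the mean
  have hvar : p * ((α + x + 1) / (N + 1)) - 2 * t * p + t ^ 2 =
      p * (1 - p) / (N + 1) + (p - t) ^ 2 := by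
    rw [hpN]
    field_simp
    ring
  have hbias : p - t = (α - t * (α + θ)) / N := by
    rw [hp, hxt, hN]
    field_simp
    ring
  have h2 : p * (1 - p) / (N + 1) ≤ 1 / κ := by
    have : p * (1 - p) ≤ 1 := by nlinarith
    gcongr
    rw [hN]
    linarith
  have h3 : (p - t) ^ 2 ≤ (α + θ) / κ := by
    have ha : |p - t| ≤ (α + θ) / N := by
      rw [hbias, abs_div, abs_of_pos hN0]
      gcongr
      rw [abs_le]
      constructor <;> nlinarith
    have hb1 : (α + θ) / N ≤ 1 := (div_le_one hN0).2 (by rw [hN]; linarith)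
    have hb2 : (α + θ) / N ≤ (α + θ) / κ := by
      gcongr
      rw [hN]
      linarith
    calc (p - t) ^ 2 = |p - t| ^ 2 := (sq_abs _).symm
      _ ≤ |p - t| * 1 := by
        rw [sq]
        gcongr
        exact ha.trans hb1
      _ ≤ _ := by rw [mul_one]; exact ha.trans hb2
  rw [hvar]
  calc _ ≤ 1 / κ + (α + θ) / κ := add_le_add h2 h3
    _ = _ := by ring

/-- The transitions of the Beta chain move by `O(κ ^ (-1/2))` in mean square, uniformly in the
current state. -/
lemma lintegral_betaChainKernel_sub_sq_le {α θ : ℝ} (hα : 0 < α) (hθ : 0 < θ) {κ : ℕ} (hκ : 0 < κ)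
    (v : I) :
    ∫⁻ y, ENNReal.ofReal (((y : ℝ) - v) ^ 2) ∂betaChainKernel κ α θ v ≤
      ENNReal.ofReal ((4 + 2 * α + 2 * θ) / κ) := by
  have hk : (0 : ℝ) < κ := by exact_mod_cast hκ
  have hv0 : (0 : ℝ) ≤ v := v.2.1
  have hv1 : (0 : ℝ) ≤ 1 - v := sub_nonneg.mpr v.2.2
  change ∫⁻ y, ENNReal.ofReal (((y : ℝ) - v) ^ 2) ∂(∑ x ∈ Finset.range (κ + 1),
    ENNReal.ofReal (κ.choose x * (v : ℝ) ^ x * (1 - (v : ℝ)) ^ (κ - x)) •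
      betaLaw (α + x) (θ + κ - x)) ≤ _
  rw [lintegral_finsetSum_measure]
  simp only [lintegral_smul_measure, smul_eq_mul]
  set B : ℕ → ℝ := fun x => κ.choose x * (v : ℝ) ^ x * (1 - (v : ℝ)) ^ (κ - x) with hB
  have hB0 : ∀ x, 0 ≤ B x := fun x => by positivity
  have hterm : ∀ x ∈ Finset.range (κ + 1), ENNReal.ofReal (B x) *
      ∫⁻ y, ENNReal.ofReal (((y : ℝ) - v) ^ 2) ∂betaLaw (α + x) (θ + κ - x) ≤
      ENNReal.ofReal (B x * (2 * ((1 + α + θ) / κ) + 2 * ((v : ℝ) - x / κ) ^ 2)) := by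
    intro x hx
    have hx := Finset.mem_range_succ_iff.1 hx
    have hx' : (x : ℝ) ≤ κ := by exact_mod_cast hx
    have := isProbabilityMeasure_betaLaw (a := α + x) (b := θ + κ - x) (by positivity) (by linarith)
    rw [ENNReal.ofReal_mul (hB0 x)]
    gcongr
    rw [← ofReal_integral_eq_lintegral_ofReal
      (integrable_of_continuous_unitInterval (by fun_prop)) (ae_of_all _ fun y => sq_nonneg _)]
    refine ENNReal.ofReal_le_ofReal ?_
    calc ∫ y, ((y : ℝ) - v) ^ 2 ∂betaLaw (α + x) (θ + κ - x)
        ≤ ∫ y, (2 * ((y : ℝ) - x / κ) ^ 2 + 2 * ((v : ℝ) - x / κ) ^ 2)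
            ∂betaLaw (α + x) (θ + κ - x) := by
          refine integral_mono (integrable_of_continuous_unitInterval (by fun_prop))
            (integrable_of_continuous_unitInterval (by fun_prop)) fun y => ?_
          have := sq_nonneg (((y : ℝ) - x / κ) + ((v : ℝ) - x / κ))
          simp only
          nlinarith
      _ = 2 * ∫ y, ((y : ℝ) - x / κ) ^ 2 ∂betaLaw (α + x) (θ + κ - x) +
            2 * ((v : ℝ) - x / κ) ^ 2 := by
          rw [integral_add (integrable_of_continuous_unitInterval (by fun_prop))
            (integrable_of_continuous_unitInterval (by fun_prop)), integral_const_mul]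
          simp
      _ ≤ _ := by
          gcongr
          exact integral_betaLaw_sub_sq_le hα hθ hκ hx
  refine (Finset.sum_le_sum hterm).trans ?_
  rw [← ENNReal.ofReal_sum_of_nonneg fun x _ => mul_nonneg (hB0 x) (by positivity)]
  refine ENNReal.ofReal_le_ofReal ?_
  have hsum : ∑ x ∈ Finset.range (κ + 1), B x = 1 := by
    have := add_pow (v : ℝ) (1 - v) κ
    rw [add_sub_cancel, one_pow] at this
    refine (Finset.sum_congr rfl fun x _ => ?_).trans this.symm
    rw [hB]
    ring
  have hbern : ∑ x ∈ Finset.range (κ + 1), B x * ((v : ℝ) - x / κ) ^ 2 ≤ 1 / κ := by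
    have h := bernstein.variance hκ.ne' v
    simp only [bernstein_apply, bernstein.z] at h
    rw [Finset.sum_range]
    calc _ = (v : ℝ) * (1 - v) / κ := by
          rw [← h]
          refine Finset.sum_congr rfl fun x _ => ?_
          rw [hB]
          ring
      _ ≤ _ := by
          gcongr
          nlinarith [v.2.2]
  calc _ = 2 * ((1 + α + θ) / κ) * ∑ x ∈ Finset.range (κ + 1), B x +
        2 * ∑ x ∈ Finset.range (κ + 1), B x * ((v : ℝ) - x / κ) ^ 2 := by
        rw [Finset.mul_sum, Finset.mul_sum, ← Finset.sum_add_distrib]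
        exact Finset.sum_congr rfl fun x _ => by ring
    _ ≤ 2 * ((1 + α + θ) / κ) * 1 + 2 * (1 / κ) := by rw [hsum]; gcongr
    _ = _ := by ring

end Moments

/-! ### The Beta chain for large `κ` -/

section ChainLimit

variable {α θ : ℝ}

lemma integrable_of_continuous_comp {Ω X : Type*} [MeasurableSpace Ω] {P : Measure Ω}
    [IsFiniteMeasure P] [TopologicalSpace X] [CompactSpace X] [MeasurableSpace X]
    [OpensMeasurableSpace X] {U : Ω → X} (hU : Measurable U) {F : X → ℝ} (hF : Continuous F) :
    Integrable (fun ω => F (U ω)) P :=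
  ((BoundedContinuousFunction.mkOfCompact ⟨F, hF⟩).integrable (P.map U)).comp_measurable hU

lemma IsBetaChain.integral_step_sq_le {Ω : Type*} [MeasurableSpace Ω] {P : Measure Ω}
    [IsProbabilityMeasure P] (hα : 0 < α) (hθ : 0 < θ) {κ : ℕ} (hκ : 0 < κ) {V : ℕ → Ω → I}
    (hV : IsBetaChain κ α θ V P) (n : ℕ) :
    ∫ ω, ((V (n + 1) ω : ℝ) - V n ω) ^ 2 ∂P ≤ (4 + 2 * α + 2 * θ) / κ := by
  have := isMarkovKernel_betaChainKernel κ hα hθ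
  have hk : (0 : ℝ) < κ := by exact_mod_cast hκ
  have hmV := hV.measurable
  have hm0 := hmV n
  have hm1 := hmV (n + 1)
  have hmH : Measurable fun ω (i : Finset.Iic n) => V i ω := measurable_pi_iff.2 fun i => hmV i
  have := Measure.isProbabilityMeasure_map (μ := P) hmH.aemeasurable
  rw [integral_eq_lintegral_of_nonneg_ae (ae_of_all _ fun ω => sq_nonneg _) (by fun_prop)]
  refine ENNReal.toReal_le_of_le_ofReal (by positivity) ?_
  let F : (Finset.Iic n → I) × I → ℝ≥0∞ := fun p =>
    ENNReal.ofReal (((p.2 : ℝ) - p.1 ⟨n, Finset.mem_Iic.mpr le_rfl⟩) ^ 2)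
  have hF : Measurable F := by fun_prop
  have h := (hV.transition n).lintegral_comp (f := F) hF.aemeasurable
  rw [Measure.lintegral_compProd hF] at h
  refine h.le.trans ?_
  calc _ ≤ ∫⁻ _, ENNReal.ofReal ((4 + 2 * α + 2 * θ) / κ)
        ∂P.map fun ω (i : Finset.Iic n) => V i ω := by
        refine lintegral_mono fun x => ?_
        rw [Kernel.comap_apply]
        exact lintegral_betaChainKernel_sub_sq_le hα hθ hκ _
    _ = _ := by simp

/-- The constant solves `c (n + 1) = 2 c n + 2`, `c 0 = 0`, from
`(x + y) ^ 2 ≤ 2 x ^ 2 + 2 y ^ 2`. -/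
lemma IsBetaChain.integral_sub_sq_le {Ω : Type*} [MeasurableSpace Ω] {P : Measure Ω}
    [IsProbabilityMeasure P] (hα : 0 < α) (hθ : 0 < θ) {κ : ℕ} (hκ : 0 < κ) {V : ℕ → Ω → I}
    (hV : IsBetaChain κ α θ V P) (n : ℕ) :
    ∫ ω, ((V n ω : ℝ) - V 0 ω) ^ 2 ∂P ≤ (2 ^ (n + 1) - 2) * ((4 + 2 * α + 2 * θ) / κ) := by
  have hmV : Measurable fun ω i => V i ω := measurable_pi_iff.2 hV.measurable
  induction n with
  | zero => simp
  | succ n ih =>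
    have h1 := hV.integral_step_sq_le hα hθ hκ n
    have hint : ∀ i j : ℕ, Integrable (fun ω => ((V i ω : ℝ) - V j ω) ^ 2) P := fun i j =>
      integrable_of_continuous_comp (F := fun v : ℕ → I => ((v i : ℝ) - v j) ^ 2) hmV
        (by fun_prop)
    calc ∫ ω, ((V (n + 1) ω : ℝ) - V 0 ω) ^ 2 ∂P
        ≤ ∫ ω, (2 * ((V (n + 1) ω : ℝ) - V n ω) ^ 2 + 2 * ((V n ω : ℝ) - V 0 ω) ^ 2) ∂P := by
          refine integral_mono (hint _ _) (((hint _ _).const_mul 2).add ((hint _ _).const_mul 2))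
            fun ω => ?_
          have := sq_nonneg (((V (n + 1) ω : ℝ) - V n ω) - ((V n ω : ℝ) - V 0 ω))
          simp only
          nlinarith
      _ = 2 * ∫ ω, ((V (n + 1) ω : ℝ) - V n ω) ^ 2 ∂P + 2 * ∫ ω, ((V n ω : ℝ) - V 0 ω) ^ 2 ∂P := by
          rw [integral_add ((hint _ _).const_mul 2) ((hint _ _).const_mul 2), integral_const_mul,
            integral_const_mul]
      _ ≤ _ := by
          rw [pow_succ 2 (n + 1)]
          linarith

/-- Uniform continuity of a continuous function on the compact space `ℕ → I`, in quadratic form. -/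
lemma exists_abs_sub_le_sum_sq {f : (ℕ → I) → ℝ} (hf : Continuous f) {ε : ℝ} (hε : 0 < ε) :
    ∃ (s : Finset ℕ) (C : ℕ → ℝ), (∀ i, 0 ≤ C i) ∧ ∀ v w : ℕ → I,
      |f v - f w| ≤ ε + ∑ i ∈ s, C i * ((v i : ℝ) - w i) ^ 2 := by
  obtain ⟨M, hM⟩ := isCompact_range hf |>.isBounded.exists_norm_le
  have hM' : ∀ v, |f v| ≤ M := fun v => hM _ (mem_range_self v)
  have hM0 : 0 ≤ M := (abs_nonneg _).trans (hM' fun _ => 0)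
  have huc := CompactSpace.uniformContinuous_of_continuous hf
  have h1 : {p : (ℕ → I) × (ℕ → I) | dist (f p.1) (f p.2) < ε} ∈ uniformity (ℕ → I) :=
    huc (Metric.dist_mem_uniformity hε)
  rw [Pi.uniformity] at h1
  have hb := Filter.HasBasis.iInf' fun i : ℕ =>
    (Metric.uniformity_basis_dist (α := I)).comap fun a : (ℕ → I) × (ℕ → I) => (a.1 i, a.2 i)
  obtain ⟨⟨s, δ⟩, ⟨hs, hδ⟩, hsub⟩ := hb.mem_iff.1 h1
  have hterm : ∀ i, 0 ≤ 2 * M / δ i ^ 2 := fun i => by positivity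
  -- If some coordinate is `δ i`-far, its summand alone dominates the oscillation `2 M` of `f`.
  refine ⟨hs.toFinset, fun i => 2 * M / δ i ^ 2, hterm, fun v w => ?_⟩
  have hnn : ∀ i ∈ hs.toFinset, 0 ≤ 2 * M / δ i ^ 2 * ((v i : ℝ) - w i) ^ 2 := fun i _ =>
    mul_nonneg (hterm i) (sq_nonneg _)
  by_cases hclose : ∀ i ∈ s, dist (v i) (w i) < δ i
  · have : (v, w) ∈ {p : (ℕ → I) × (ℕ → I) | dist (f p.1) (f p.2) < ε} :=
      hsub (by simpa using hclose)
    have h2 : |f v - f w| < ε := this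
    have := Finset.sum_nonneg hnn
    linarith
  · push Not at hclose
    obtain ⟨i, hi, hd⟩ := hclose
    have hδi : 0 < δ i := hδ i hi
    have h3 : 2 * M ≤ 2 * M / δ i ^ 2 * ((v i : ℝ) - w i) ^ 2 := by
      have : δ i ^ 2 ≤ ((v i : ℝ) - w i) ^ 2 := by
        rw [← sq_abs ((v i : ℝ) - w i)]
        gcongr
        exact hd
      rw [div_mul_eq_mul_div, le_div_iff₀ (by positivity)]
      gcongr
    have h4 := Finset.single_le_sum hnn (hs.mem_toFinset.2 hi)
    have h5 : |f v - f w| ≤ |f v| + |f w| := abs_sub _ _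
    have := hM' v
    have := hM' w
    simp only at h4
    linarith

/-- As `κ → ∞`, the Beta chain converges in distribution, as a random sequence, to the constant
sequence at a `Be(α, θ)` variable. -/
lemma tendsto_integral_betaChain (hα : 0 < α) (hθ : 0 < θ) {Ω : ℕ → Type*}
    [∀ κ, MeasurableSpace (Ω κ)] {P : ∀ κ, Measure (Ω κ)} [∀ κ, IsProbabilityMeasure (P κ)]
    {V : ∀ κ, ℕ → Ω κ → I} (hV : ∀ κ, IsBetaChain κ α θ (V κ) (P κ)) {f : (ℕ → I) → ℝ}
    (hf : Continuous f) :
    Tendsto (fun κ => ∫ ω, f (fun i => V κ i ω) ∂P κ) atTop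
      (𝓝 (∫ v, f (fun _ => v) ∂betaLaw α θ)) := by
  have hmV : ∀ κ, Measurable fun ω i => V κ i ω := fun κ => measurable_pi_iff.2 (hV κ).measurable
  have hlaw : ∀ κ, ∫ ω, f (fun _ => V κ 0 ω) ∂P κ = ∫ v, f (fun _ => v) ∂betaLaw α θ := fun κ =>
    (hV κ).initial.integral_comp (f := fun v => f fun _ => v)
      (by fun_prop : Continuous fun v : I => f fun _ => v).aestronglyMeasurable
  rw [Metric.tendsto_atTop']
  intro ε hε
  obtain ⟨s, C, hC, hbound⟩ := exists_abs_sub_le_sum_sq hf (half_pos hε)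
  set K : ℝ := ∑ i ∈ s, C i * (2 ^ (i + 1) - 2) with hK
  have hlim : Tendsto (fun κ : ℕ => K * ((4 + 2 * α + 2 * θ) / κ)) atTop (𝓝 0) := by
    simpa using (tendsto_const_div_atTop_nhds_zero_nat (4 + 2 * α + 2 * θ)).const_mul K
  obtain ⟨N, hN⟩ := eventually_atTop.1 (hlim.eventually_lt_const (half_pos hε))
  refine ⟨N, fun κ hκN => ?_⟩
  have hκ : 0 < κ := (Nat.zero_le N).trans_lt hκN
  have hNκ := hN κ hκN.le
  have hi1 : Integrable (fun ω => f fun i => V κ i ω) (P κ) :=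
    integrable_of_continuous_comp (hmV κ) hf
  have hi2 : Integrable (fun ω => f fun _ => V κ 0 ω) (P κ) :=
    integrable_of_continuous_comp (F := fun v : ℕ → I => f fun _ => v 0) (hmV κ) (by fun_prop)
  have hi3 : ∀ i, Integrable (fun ω => C i * ((V κ i ω : ℝ) - V κ 0 ω) ^ 2) (P κ) := fun i =>
    integrable_of_continuous_comp (F := fun v : ℕ → I => C i * ((v i : ℝ) - v 0) ^ 2) (hmV κ)
      (by fun_prop)
  rw [← hlaw κ, Real.dist_eq, ← integral_sub hi1 hi2]
  calc |∫ ω, (f (fun i => V κ i ω) - f fun _ => V κ 0 ω) ∂P κ|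
      ≤ ∫ ω, |f (fun i => V κ i ω) - f fun _ => V κ 0 ω| ∂P κ := abs_integral_le_integral_abs
    _ ≤ ∫ ω, (ε / 2 + ∑ i ∈ s, C i * ((V κ i ω : ℝ) - V κ 0 ω) ^ 2) ∂P κ := by
        refine integral_mono (hi1.sub hi2).abs
          ((integrable_const _).add (integrable_finsetSum _ fun i _ => hi3 i)) fun ω => ?_
        exact hbound _ _
    _ = ε / 2 + ∑ i ∈ s, C i * ∫ ω, ((V κ i ω : ℝ) - V κ 0 ω) ^ 2 ∂P κ := by
        rw [integral_add (integrable_const _) (integrable_finsetSum _ fun i _ => hi3 i),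
          integral_finsetSum _ fun i _ => hi3 i]
        simp [integral_const_mul]
    _ ≤ ε / 2 + K * ((4 + 2 * α + 2 * θ) / κ) := by
        rw [hK, Finset.sum_mul]
        refine add_le_add le_rfl (Finset.sum_le_sum fun i _ => ?_)
        rw [mul_assoc]
        exact mul_le_mul_of_nonneg_left ((hV κ).integral_sub_sq_le hα hθ hκ i) (hC i)
    _ < ε := by linarith

end ChainLimit

/-! ### Convergence of species sampling processes -/

section SpeciesMeasure

lemma lowerSemicontinuous_weight_mul_indicator {S : Type*} [TopologicalSpace S] {U : Set S}
    (hU : IsOpen U) (j : ℕ) :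
    LowerSemicontinuous fun z : (ℕ → I) × (ℕ → S) =>
      ENNReal.ofReal (z.1 j) * U.indicator 1 (z.2 j) := by
  intro z c hc
  by_cases hz : z.2 j ∈ U
  · have hcont : Continuous fun z : (ℕ → I) × (ℕ → S) => ENNReal.ofReal (z.1 j) :=
      ENNReal.continuous_ofReal.comp (by fun_prop)
    have hc' : c < ENNReal.ofReal (z.1 j) := by simpa [hz] using hc
    have hopen : IsOpen {z : (ℕ → I) × (ℕ → S) | z.2 j ∈ U} :=
      hU.preimage (by fun_prop)
    filter_upwards [hcont.continuousAt.eventually_const_lt hc', hopen.mem_nhds hz] with y hy hyU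
    have hyU : y.2 j ∈ U := hyU
    simpa [hyU] using hy
  · simp [hz] at hc

variable {S : Type*}

/-- Pairs of a sequence of weights that sum to one and a sequence of atoms. -/
def properPairs (S : Type*) : Set ((ℕ → I) × (ℕ → S)) :=
  {z | ∑' j, ENNReal.ofReal (z.1 j) = 1}

variable [MeasurableSpace S]

/-- The discrete probability measure `∑ j, w j • δ_{x j}` with weights `w` and atoms `x`. -/
noncomputable def speciesMeasure (z : properPairs S) : ProbabilityMeasure S :=
  ⟨Measure.sum fun j => ENNReal.ofReal (z.1.1 j : ℝ) • Measure.dirac (z.1.2 j), ⟨by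
    rw [measure_sum_dirac_apply _ _ MeasurableSet.univ]
    have hz : ∑' j, ENNReal.ofReal (z.1.1 j) = 1 := z.2
    simpa using hz⟩⟩

variable [TopologicalSpace S]

/-- The measure depends continuously on weights and atoms: the mass of an open set is a sum of
lower semicontinuous functions, which is all that the portmanteau theorem requires since the total
mass is fixed. -/
lemma continuous_speciesMeasure [FirstCountableTopology S] [OpensMeasurableSpace S]
    [HasOuterApproxClosed S] : Continuous (speciesMeasure (S := S)) := by
  refine continuous_iff_continuousAt.2 fun z => ?_
  refine tendsto_of_forall_isOpen_le_liminf' fun U hU => ?_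
  have hlsc : LowerSemicontinuous fun z : properPairs S => (speciesMeasure z : Measure S) U := by
    have h : ∀ z : properPairs S, (speciesMeasure z : Measure S) U =
        ∑' j, ENNReal.ofReal (z.1.1 j) * U.indicator 1 (z.1.2 j) := fun z =>
      measure_sum_dirac_apply _ _ hU.measurableSet
    simp_rw [h]
    exact (lowerSemicontinuous_tsum fun j =>
      lowerSemicontinuous_weight_mul_indicator hU j).comp continuous_subtype_val
  exact lowerSemicontinuousAt_iff_le_liminf.1 (hlsc z)

end SpeciesMeasure

section SpeciesLimit

lemma map_atoms_eq_infinitePi {S : Type*} [MeasurableSpace S] {Ω : Type*} [MeasurableSpace Ω]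
    {P : Measure Ω} [IsProbabilityMeasure P] {P₀ : Measure S} [IsProbabilityMeasure P₀]
    {ξ : ℕ → Ω → S} (hξ : ∀ j, Measurable (ξ j)) (hl : ∀ j, HasLaw (ξ j) P₀ P)
    (hi : iIndepFun ξ P) :
    P.map (fun ω j => ξ j ω) = Measure.infinitePi fun _ => P₀ := by
  rw [(iIndepFun_iff_map_fun_eq_infinitePi_map hξ).1 hi]
  simp_rw [fun j => (hl j).map_eq]

variable {S : Type*} [TopologicalSpace S] [PolishSpace S] [MeasurableSpace S] [BorelSpace S]

/-- Since the atoms are independent of the weights and their law is fixed, they can be integrated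
out. -/
lemma integral_weights_atoms {Ω : Type*} [MeasurableSpace Ω] {P : Measure Ω}
    [IsProbabilityMeasure P] {P₀ : Measure S} [IsProbabilityMeasure P₀] {W : ℕ → Ω → I}
    (hW : ∀ j, Measurable (W j)) {ξ : ℕ → Ω → S}
    (hξ : ∀ j, Measurable (ξ j)) (hl : ∀ j, HasLaw (ξ j) P₀ P) (hi : iIndepFun ξ P)
    (hind : IndepFun (fun ω j => W j ω) (fun ω j => ξ j ω) P)
    (G : BoundedContinuousFunction ((ℕ → I) × (ℕ → S)) ℝ) :
    ∫ z, G z ∂P.map (fun ω => (fun j => W j ω, fun j => ξ j ω)) =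
      ∫ ω, (∫ x, G (fun j => W j ω, x) ∂Measure.infinitePi fun _ => P₀) ∂P := by
  have hW' : Measurable fun ω j => W j ω := measurable_pi_iff.2 hW
  have hξ' : Measurable fun ω j => ξ j ω := measurable_pi_iff.2 hξ
  have := Measure.isProbabilityMeasure_map (μ := P) hW'.aemeasurable
  rw [(indepFun_iff_map_prod_eq_prod_map_map hW'.aemeasurable hξ'.aemeasurable).1 hind,
    map_atoms_eq_infinitePi hξ hl hi, integral_prod _ (G.integrable _)]
  refine integral_map hW'.aemeasurable ?_
  exact G.continuous.aestronglyMeasurable.integral_prod_right'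

lemma continuous_integral_atoms {Q : Measure (ℕ → S)} [IsFiniteMeasure Q]
    (G : BoundedContinuousFunction ((ℕ → I) × (ℕ → S)) ℝ) :
    Continuous fun w => ∫ x, G (w, x) ∂Q := by
  refine continuous_of_dominated (bound := fun _ => ‖G‖) (fun w => ?_)
    (fun w => ae_of_all _ fun x => G.norm_coe_le_norm _) (integrable_const _)
    (ae_of_all _ fun x => by fun_prop)
  exact (by fun_prop : Continuous fun x => G (w, x)).aestronglyMeasurable

/-- For a random measure that is almost surely the image of its weights and atoms, the probability
of an open set of measures is read off from the law of weights and atoms. -/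
lemma map_apply_eq_of_ae_eq_sum {U : Set (ProbabilityMeasure S)} (hU : IsOpen U)
    {O : Set ((ℕ → I) × (ℕ → S))} (hO : IsOpen O)
    (hOU : Subtype.val ⁻¹' O = speciesMeasure ⁻¹' U)
    {Ω : Type*} [MeasurableSpace Ω] {P : Measure Ω} {μ : Ω → ProbabilityMeasure S}
    {Z : Ω → (ℕ → I) × (ℕ → S)} (hμ : Measurable μ) (hZ : Measurable Z)
    (hae : ∀ᵐ ω ∂P, (μ ω : Measure S) =
      Measure.sum fun j => ENNReal.ofReal ((Z ω).1 j : ℝ) • Measure.dirac ((Z ω).2 j)) :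
    P.map μ U = P.map Z O := by
  rw [Measure.map_apply hμ hU.measurableSet, Measure.map_apply hZ hO.measurableSet]
  refine measure_congr ?_
  filter_upwards [hae] with ω hω
  have hmem : Z ω ∈ properPairs S := tsum_weights_eq_one hω
  have heq : μ ω = speciesMeasure ⟨Z ω, hmem⟩ := Subtype.ext hω
  have h1 : Z ω ∈ O ↔ speciesMeasure ⟨Z ω, hmem⟩ ∈ U :=
    Set.ext_iff.1 hOU (⟨Z ω, hmem⟩ : properPairs S)
  exact propext ((iff_of_eq (congrArg (· ∈ U) heq)).trans h1.symm)

/-- If the weights of species sampling processes with the same base measure converge in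
distribution, then so do the processes. -/
theorem tendstoInDistribution_of_isSpeciesSampling {P₀ : Measure S} [IsProbabilityMeasure P₀]
    {Ω : ℕ → Type*} [∀ κ, MeasurableSpace (Ω κ)] {P : ∀ κ, Measure (Ω κ)}
    [∀ κ, IsProbabilityMeasure (P κ)] {W : ∀ κ, ℕ → Ω κ → I} (hWm : ∀ κ j, Measurable (W κ j))
    {μ : ∀ κ, Ω κ → ProbabilityMeasure S} (hμ : ∀ κ, IsSpeciesSampling (W κ) P₀ (μ κ) (P κ))
    {Ω' : Type*} [MeasurableSpace Ω'] {P' : Measure Ω'} [IsProbabilityMeasure P']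
    {W' : ℕ → Ω' → I} (hWm' : ∀ j, Measurable (W' j)) {μ' : Ω' → ProbabilityMeasure S}
    (hμ' : IsSpeciesSampling W' P₀ μ' P')
    (hlim : ∀ f : (ℕ → I) → ℝ, Continuous f →
      Tendsto (fun κ => ∫ ω, f (fun j => W κ j ω) ∂P κ) atTop (𝓝 (∫ ω, f (fun j => W' j ω) ∂P'))) :
    TendstoInDistribution μ atTop μ' P P' := by
  have hμm := fun κ => (hμ κ).measurable
  have hμm' := hμ'.measurable
  choose ξ hξ hξl hξi hind hsum using fun κ => (hμ κ).exists_atoms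
  obtain ⟨ξ', hξ', hξl', hξi', hind', hsum'⟩ := hμ'.exists_atoms
  have hZ : ∀ κ, Measurable fun ω => (fun j => W κ j ω, fun j => ξ κ j ω) := fun κ =>
    (measurable_pi_iff.2 (hWm κ)).prodMk (measurable_pi_iff.2 (hξ κ))
  have hZ' : Measurable fun ω => (fun j => W' j ω, fun j => ξ' j ω) :=
    (measurable_pi_iff.2 hWm').prodMk (measurable_pi_iff.2 hξ')
  let ν : ℕ → ProbabilityMeasure ((ℕ → I) × (ℕ → S)) := fun κ =>
    ⟨(P κ).map _, Measure.isProbabilityMeasure_map (hZ κ).aemeasurable⟩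
  let ν' : ProbabilityMeasure ((ℕ → I) × (ℕ → S)) :=
    ⟨P'.map _, Measure.isProbabilityMeasure_map hZ'.aemeasurable⟩
  have hν : Tendsto ν atTop (𝓝 ν') := by
    refine ProbabilityMeasure.tendsto_iff_forall_integral_tendsto.2 fun G => ?_
    simp only [ν, ν', ProbabilityMeasure.coe_mk]
    rw [integral_weights_atoms hWm' hξ' hξl' hξi' hind' G]
    simp_rw [fun κ => integral_weights_atoms (hWm κ) (hξ κ) (hξl κ) (hξi κ) (hind κ) G]
    exact hlim _ (continuous_integral_atoms G)
  refine ⟨fun κ => (hμm κ).aemeasurable, hμm'.aemeasurable, ?_⟩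
  refine tendsto_of_forall_isOpen_le_liminf' fun U hU => ?_
  obtain ⟨O, hO, hOU⟩ := isOpen_induced_iff.1 (hU.preimage (continuous_speciesMeasure (S := S)))
  have h2 := ProbabilityMeasure.le_liminf_measure_open_of_tendsto hν hO
  simp only [ν, ν', ProbabilityMeasure.coe_mk] at h2 ⊢
  rw [map_apply_eq_of_ae_eq_sum hU hO hOU hμm' hZ' hsum']
  simp_rw [fun κ => map_apply_eq_of_ae_eq_sum hU hO hOU (hμm κ) (hZ κ) (hsum κ)]
  exact h2

/-- As `κ → ∞` the Beta-Binomial stick-breaking priors converge in distribution to the Geometric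
process. -/
theorem tendstoInDistribution_of_isBBSBPrior {α θ : ℝ} (hα : 0 < α) (hθ : 0 < θ) {P₀ : Measure S}
    [IsProbabilityMeasure P₀] {Ω : ℕ → Type*} [∀ κ, MeasurableSpace (Ω κ)]
    {P : ∀ κ, Measure (Ω κ)} [∀ κ, IsProbabilityMeasure (P κ)]
    {μ : ∀ κ, Ω κ → ProbabilityMeasure S} (hμ : ∀ κ, IsBBSBPrior κ α θ P₀ (μ κ) (P κ))
    {Ω' : Type*} [MeasurableSpace Ω'] {P' : Measure Ω'} [IsProbabilityMeasure P']
    {μ' : Ω' → ProbabilityMeasure S} (hμ' : IsGeometricProcess α θ P₀ μ' P') :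
    TendstoInDistribution μ atTop μ' P P' := by
  choose V hV hS using hμ
  obtain ⟨l, hlm, hll, hS'⟩ := hμ'
  refine tendstoInDistribution_of_isSpeciesSampling (fun κ j => ?_) hS (fun j => ?_) hS'
    fun f hf => ?_
  · exact (continuous_stickBreaking j).measurable.comp (measurable_pi_iff.2 (hV κ).measurable)
  · exact (by fun_prop : Continuous fun v : I => v * σ v ^ j).measurable.comp hlm
  · have hcont : Continuous fun v : ℕ → I => f (stickBreaking v) :=
      hf.comp (continuous_pi continuous_stickBreaking)
    have hgeom : ∫ ω, f (fun j => l ω * σ (l ω) ^ j) ∂P' =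
        ∫ v, f (stickBreaking fun _ => v) ∂betaLaw α θ := by
      have hc : Continuous fun v : I => f (stickBreaking fun _ => v) :=
        hcont.comp (continuous_pi fun _ => continuous_id)
      refine Eq.trans ?_ (hll.integral_comp hc.aestronglyMeasurable)
      refine integral_congr_ae (ae_of_all _ fun ω => congrArg f ?_)
      ext j
      simp [stickBreaking]
    rw [hgeom]
    exact tendsto_integral_betaChain hα hθ hV hcont

end SpeciesLimit

end BBSB

theorem mainTheorem2 {S : Type*} [TopologicalSpace S] [PolishSpace S] [MeasurableSpace S]
    [BorelSpace S] (P₀ : Measure S) [IsProbabilityMeasure P₀] [NullSingletonClass P₀] :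
    (∀ (θ : ℝ), 0 < θ →
      ∀ {Ω : Type*} [MeasurableSpace Ω] (P : Measure Ω) [IsProbabilityMeasure P]
        (μ : Ω → ProbabilityMeasure S),
        BBSB.IsBBSBPrior 0 1 θ P₀ μ P → BBSB.IsDirichletProcess θ P₀ μ P) ∧
    (∀ (α θ : ℝ), 0 < α → 0 < θ →
      ∀ {Ω : ℕ → Type*} [∀ κ, MeasurableSpace (Ω κ)] (P : ∀ κ, Measure (Ω κ))
        [∀ κ, IsProbabilityMeasure (P κ)] (μ : ∀ κ, Ω κ → ProbabilityMeasure S)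
        {Ω' : Type*} [MeasurableSpace Ω'] (P' : Measure Ω') [IsProbabilityMeasure P']
        (μ' : Ω' → ProbabilityMeasure S),
        (∀ κ, BBSB.IsBBSBPrior κ α θ P₀ (μ κ) (P κ)) →
        BBSB.IsGeometricProcess α θ P₀ μ' P' →
        TendstoInDistribution μ atTop μ' P P') := by
  refine ⟨?_, ?_⟩
  · intro θ hθ Ω _ P _ μ hμ
    exact BBSB.isDirichletProcess_of_isBBSBPrior hθ hμ
  · intro α θ hα hθ Ω _ P _ μ Ω' _ P' _ μ' hμ hμ'
    exact BBSB.tendstoInDistribution_of_isBBSBPrior hα hθ hμ hμ'
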